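/- Let $1<p<r\le 2$. There is a constant $C_{p,r}>0$, depending only on $p$ and $r$, such that the following holds. Let $D>0$ and let $(\mathcal X,|\cdot|)$ be a separable real Banach space which is $(r,D)$-smooth, in the sense that for all $N$ and all integrable $\mathcal X$-valued martingale differences $d_1,\dots,d_N$ on a probability space with a filtration $(\mathcal G_n)_{0\le n\le N}$ (that is, $d_n$ is $\mathcal G_n$-measurable and $\mathbb E(d_n\mid\mathcal G_{n-1})=0$ for $1\le n\le N$), $$\mathbb E\,|d_1+\dots+d_N|^r\le D^r\sum_{n=1}^N\mathbb E\,|d_n|^r .$$ Let $(\Omega,\mathcal F,\mathbb P)$ be a probability space, $\theta:\Omega\to\Omega$ an invertible, bi-measurable, measure preserving transformation, and $\mathcal F_0\subset\mathcal F$ a $\sigma$-algebra with $\mathcal F_0\subset\theta^{-1}(\mathcal F_0)$. For $n\in\mathbb Z$ put $\mathcal F_n=\theta^{-n}(\mathcal F_0)$, $\mathbb E_n=\mathbb E(\cdot\mid\mathcal F_n)$ and $P_n=\mathbb E_n-\mathbb E_{n-1}$; put also $\mathcal F_{-\infty}=\bigcap_{n\in\mathbb Z}\mathcal F_n$ and $\mathcal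 F_\infty=\bigvee_{n\in\mathbb Z}\mathcal F_n$. Let $X\in L^p(\Omega,\mathcal F,\mathbb P,\mathcal X)$ be regular, that is, $\mathbb E(X\mid\mathcal F_{-\infty})=0$ and $\mathbb E(X\mid\mathcal F_\infty)=X$ almost surely, and assume that $$\|X\|_{H_p}:=\sum_{n\in\mathbb Z}\|P_nX\|_p<\infty,\qquad\text{where } \|Z\|_p=(\mathbb E|Z|^p)^{1/p}.$$ Write $S_n(X)=\sum_{k=0}^{n-1}X\circ\theta^k$, $\mathcal M_p(X)=\sup_{n\ge1}|S_n(X)|/n^{1/p}$ and $\|Z\|_{p,\infty}=\sup_{t>0}t\,\mathbb P(|Z|>t)^{1/p}$. Then $$\|\mathcal M_p(X)\|_{p,\infty}\le C_{p,r}\,D^{r/p}\,\|X\|_{H_p},$$ and moreover $|S_n(X)|/n^{1/p}\to0$ almost surely as $n\to\infty$. -/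

import Mathlib

open MeasureTheory Filter
open scoped ENNReal Topology

universe u w

/-- The space `E` is `(r, D)`-smooth: for all martingale differences `d 0, …, d (N - 1)` on a
probability space, where `d n` is `𝒢 (n + 1)`-measurable and `𝔼(d n | 𝒢 n) = 0`, one has
`𝔼 |d 0 + ⋯ + d (N - 1)| ^ r ≤ D ^ r * ∑ n < N, 𝔼 |d n| ^ r` (the right-hand side may be `∞`). -/
def IsSmoothSpace (r D : ℝ) (E : Type w) [NormedAddCommGroup E] [NormedSpace ℝ E]
    [CompleteSpace E] : Prop :=
  ∀ (S : Type u) [mS : MeasurableSpace S] (ν : Measure S) [IsProbabilityMeasure ν]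
    (𝒢 : Filtration ℕ mS) (N : ℕ) (d : ℕ → S → E),
    (∀ n < N, StronglyMeasurable[𝒢 (n + 1)] (d n)) →
    (∀ n < N, Integrable (d n) ν) →
    (∀ n < N, ν[d n | 𝒢 n] =ᵐ[ν] 0) →
    ∫⁻ s, ‖∑ n ∈ Finset.range N, d n s‖ₑ ^ r ∂ν
      ≤ ENNReal.ofReal (D ^ r) * ∑ n ∈ Finset.range N, ∫⁻ s, ‖d n s‖ₑ ^ r ∂ν

section Hannan

variable {Ω : Type u} {E : Type w} [NormedAddCommGroup E]

/-- The σ-algebra `ℱ n = θ ^ (-n) (ℱ 0)`, the family of preimages under `θ ^ n` of the members of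
`ℱ 0`, for every integer `n`. -/
@[reducible] def shiftAlgebra (F₀ : MeasurableSpace Ω) [MeasurableSpace Ω] (θ : Ω ≃ᵐ Ω) (n : ℤ) :
    MeasurableSpace Ω :=
  F₀.comap ((θ.toEquiv : Equiv.Perm Ω) ^ n : Equiv.Perm Ω)

/-- `P n X = 𝔼(X | ℱ n) - 𝔼(X | ℱ (n - 1))`. -/
noncomputable def projDiff (F₀ : MeasurableSpace Ω) [MeasurableSpace Ω] [NormedSpace ℝ E] [CompleteSpace E]
    (μ : Measure Ω) (θ : Ω ≃ᵐ Ω) (n : ℤ) (X : Ω → E) : Ω → E :=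
  μ[X | shiftAlgebra F₀ θ n] - μ[X | shiftAlgebra F₀ θ (n - 1)]

/-- `X` is regular: integrable, with `𝔼(X | ⋂ n, ℱ n) = 0` and `X = 𝔼(X | ⋁ n, ℱ n)` a.s. -/
def IsRegularVariable (F₀ : MeasurableSpace Ω) [MeasurableSpace Ω] [NormedSpace ℝ E] [CompleteSpace E]
    (μ : Measure Ω) (θ : Ω ≃ᵐ Ω) (X : Ω → E) : Prop :=
  Integrable X μ ∧
    μ[X | ⨅ n : ℤ, shiftAlgebra F₀ θ n] =ᵐ[μ] 0 ∧
    X - μ[X | ⨆ n : ℤ, shiftAlgebra F₀ θ n] =ᵐ[μ] 0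

/-- `‖X‖_{H_p} = ∑ n : ℤ, ‖P n X‖_p`, with values in `[0, ∞]`. -/
noncomputable def hannanNorm (F₀ : MeasurableSpace Ω) [MeasurableSpace Ω] [NormedSpace ℝ E] [CompleteSpace E]
    (μ : Measure Ω) (θ : Ω ≃ᵐ Ω) (p : ℝ) (X : Ω → E) : ℝ≥0∞ :=
  ∑' n : ℤ, eLpNorm (projDiff F₀ μ θ n X) (ENNReal.ofReal p) μ

/-- `M_p(X) = sup_{n ≥ 1} |S_n(X)| / n ^ (1 / p)`, with values in `[0, ∞]`. -/
noncomputable def mzMaximal (θ : Ω → Ω) (p : ℝ) (X : Ω → E) (ω : Ω) : ℝ≥0∞ :=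
  ⨆ (n : ℕ) (_ : 1 ≤ n), ‖birkhoffSum θ X n ω‖ₑ / (n : ℝ≥0∞) ^ (1 / p)

/-- `‖f‖_{p,∞} = sup_{t > 0} t * μ(f > t) ^ (1 / p)` for `f` with values in `[0, ∞]`. -/
noncomputable def weakLpNorm [MeasurableSpace Ω] (μ : Measure Ω) (p : ℝ) (f : Ω → ℝ≥0∞) : ℝ≥0∞ :=
  ⨆ (t : ℝ) (_ : 0 < t), ENNReal.ofReal t * μ {ω | ENNReal.ofReal t < f ω} ^ (1 / p)

end Hannan

/-! A regular `X` with finite Hannan norm is almost surely the sum of its increments `P n X`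
(`hasSum_projDiff`). For fixed `n`, the shifts of `P n X` under the iterates of `θ` are stationary
martingale differences for the filtration `k ↦ ℱ (n - 1 + k)`. Hence the theorem reduces to a
weak-type bound for one such sequence and a way of adding the bounds over `n`.

For one sequence generated by `Y` (`measure_exists_lt_norm_birkhoffSum_le`), truncate the `k`-th
term at `b k = (k + 1) ^ (1 / p)`. The events where a term exceeds `b k` have total probability at
most `𝔼 |Y| ^ p`. The compensators of the truncated terms, divided by `b k`, are summable in `L¹`
because `p > 1`. The centred truncated terms, divided by `b k`, have summable `r`-th moments because
`p < r`, so smoothness applied to a stopped martingale controls all their partial sums, and Abel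
summation puts the weights back. Scaling gives every level `t`.

Since `p > 1`, weak `L^p` satisfies a countable triangle inequality up to a constant
(`rpow_mul_measure_lt_tsum_le`), which adds the bounds linearly in `‖P n X‖_p`. The `p`-th root of
the factor `D ^ r` is `D ^ (r / p)`.

The strong law is stable under approximation in the weak-type seminorm of the maximal function
(`HasMZLaw.of_approx`). Finite sums of increments approximate `X`, and differences coming from
bounded variables approximate each increment. The latter obey a weak-type bound at some exponent `q`
with `p < q < r`, whence `S_n = O(n ^ (1 / q)) = o(n ^ (1 / p))`. -/

/-! ### Elementary estimates for truncation sums. -/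

/-- Discrete form of `∫ x ^ (a - 1)` over `[0, y]`: by Bernoulli's inequality each term is at most
an increment of `x ^ a / a`. Capping with `min y` builds the cutoff into the telescoping sum. -/
lemma sum_ite_rpow_sub_one_le {a y : ℝ} (ha : 0 < a) (ha1 : a ≤ 1) (hy : 0 ≤ y) (N : ℕ) :
    ∑ k ∈ Finset.range N, (if (k : ℝ) + 1 < y then ((k : ℝ) + 1) ^ (a - 1) else 0) ≤ y ^ a / a := by
  have key : ∀ k : ℕ, (if (k : ℝ) + 1 < y then ((k : ℝ) + 1) ^ (a - 1) else 0) ≤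
      (min y ((k + 1 : ℕ) : ℝ)) ^ a / a - (min y (k : ℝ)) ^ a / a := by
    intro k
    rw [← sub_div, le_div_iff₀ ha]
    have hk : (0 : ℝ) ≤ k := k.cast_nonneg
    split_ifs with h
    · rw [min_eq_right (by push_cast; linarith), min_eq_right (by linarith)]
      have hz : (0 : ℝ) < (k : ℝ) + 1 := by linarith
      have h1 : (k : ℝ) ^ a = ((k : ℝ) + 1) ^ a * (1 + -(1 / ((k : ℝ) + 1))) ^ a := by
        have h0 : (0 : ℝ) ≤ 1 + -(1 / ((k : ℝ) + 1)) := by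
          have : 1 / ((k : ℝ) + 1) ≤ 1 := by rw [div_le_one hz]; linarith
          linarith
        rw [← Real.mul_rpow hz.le h0]
        congr 1
        field_simp
        ring
      have h2 : (1 + -(1 / ((k : ℝ) + 1))) ^ a ≤ 1 + a * -(1 / ((k : ℝ) + 1)) := by
        apply rpow_one_add_le_one_add_mul_self _ ha.le ha1
        have : 1 / ((k : ℝ) + 1) ≤ 1 := by rw [div_le_one hz]; linarith
        linarith
      have h3 : ((k : ℝ) + 1) ^ (a - 1) = ((k : ℝ) + 1) ^ a * (1 / ((k : ℝ) + 1)) := by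
        rw [Real.rpow_sub_one hz.ne']; ring
      have h4 := mul_le_mul_of_nonneg_left h2 (Real.rpow_nonneg hz.le a)
      rw [← h1] at h4
      push_cast
      rw [h3]
      linarith
    · rw [zero_mul, sub_nonneg]
      exact Real.rpow_le_rpow (le_min hy hk) (min_le_min le_rfl (by push_cast; linarith)) ha.le
  calc _ ≤ ∑ k ∈ Finset.range N, ((min y ((k + 1 : ℕ) : ℝ)) ^ a / a - (min y (k : ℝ)) ^ a / a) :=
        Finset.sum_le_sum fun k _ => key k
    _ = (min y (N : ℝ)) ^ a / a - (min y ((0 : ℕ) : ℝ)) ^ a / a :=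
        Finset.sum_range_sub (fun k : ℕ => (min y (k : ℝ)) ^ a / a) N
    _ ≤ (min y (N : ℝ)) ^ a / a := by
        rw [sub_le_self_iff]
        have : 0 ≤ min y ((0 : ℕ) : ℝ) := le_min hy (by simp)
        positivity
    _ ≤ y ^ a / a := by
        have : 0 ≤ min y (N : ℝ) := le_min hy (by simp)
        gcongr
        exact min_le_left _ _

/-- Tail counterpart of the previous estimate, telescoping `x ^ (-e)` with the cutoff built in by
`max y`. -/
lemma sum_ite_rpow_neg_le {e y : ℝ} (he : 0 < e) (he1 : e ≤ 1) (hy : 0 < y) (N : ℕ) :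
    ∑ k ∈ Finset.range N, (if y ≤ (k : ℝ) + 1 then ((k : ℝ) + 1) ^ (-1 - e) else 0)
      ≤ 2 / e * y ^ (-e) := by
  have hpos : ∀ k : ℕ, 0 < max y ((k : ℝ) + 1) := fun k => lt_max_of_lt_left hy
  have key : ∀ k : ℕ, (if y ≤ (k : ℝ) + 1 then ((k : ℝ) + 1) ^ (-1 - e) else 0) ≤
      2 / e * (max y ((k : ℝ) + 1)) ^ (-e) -
        2 / e * (max y (((k + 1 : ℕ) : ℝ) + 1)) ^ (-e) := by
    intro k
    rw [← mul_sub]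
    have hk : (0 : ℝ) ≤ k := k.cast_nonneg
    have hz : (0 : ℝ) < (k : ℝ) + 1 := by linarith
    split_ifs with h
    · rw [max_eq_right h, max_eq_right (by push_cast; linarith)]
      push_cast
      set z : ℝ := (k : ℝ) + 1 with hz_def
      have hz1 : 1 ≤ z := by linarith
      have h1 : (z + 1) ^ (-e) = z ^ (-e) * (1 + -(1 / (z + 1))) ^ e := by
        have : 1 + -(1 / (z + 1)) = z / (z + 1) := by field_simp; ring
        rw [this, Real.div_rpow hz.le (by linarith), Real.rpow_neg hz.le,
          Real.rpow_neg (by linarith)]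
        have : z ^ e ≠ 0 := (Real.rpow_pos_of_pos hz e).ne'
        field_simp
      -- Bernoulli yields `1 / (z + 1)` where `1 / z` is wanted; since `z ≥ 1`, this costs the
      -- factor 2 in the constant.
      have hw : 1 / (2 * z) ≤ 1 / (z + 1) :=
        one_div_le_one_div_of_le (by linarith) (by linarith)
      have h2 : (1 + -(1 / (z + 1))) ^ e ≤ 1 + e * -(1 / (z + 1)) := by
        apply rpow_one_add_le_one_add_mul_self _ he.le he1
        have : 1 / (z + 1) ≤ 1 := by rw [div_le_one (by linarith)]; linarith
        linarith
      have h2' : (1 + -(1 / (z + 1))) ^ e ≤ 1 - e * (1 / (2 * z)) := by nlinarith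
      have h4 := mul_le_mul_of_nonneg_left h2' (Real.rpow_nonneg hz.le (-e))
      rw [← h1] at h4
      have h3 : z ^ (-1 - e) = z ^ (-e) * (1 / z) := by
        rw [show -1 - e = -e - 1 by ring, Real.rpow_sub_one hz.ne']; ring
      rw [h3]
      calc z ^ (-e) * (1 / z) = 2 / e * (z ^ (-e) - z ^ (-e) * (1 - e * (1 / (2 * z)))) := by
            field_simp; ring
        _ ≤ _ := by gcongr
    · apply mul_nonneg (by positivity)
      rw [sub_nonneg]
      exact Real.rpow_le_rpow_of_nonpos (hpos k)
        (max_le_max le_rfl (by push_cast; linarith)) (by linarith)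
  calc _ ≤ ∑ k ∈ Finset.range N, (2 / e * (max y ((k : ℝ) + 1)) ^ (-e) -
        2 / e * (max y (((k + 1 : ℕ) : ℝ) + 1)) ^ (-e)) := Finset.sum_le_sum fun k _ => key k
    _ = 2 / e * (max y (((0 : ℕ) : ℝ) + 1)) ^ (-e) - 2 / e * (max y ((N : ℝ) + 1)) ^ (-e) :=
        Finset.sum_range_sub' (fun k : ℕ => 2 / e * (max y ((k : ℝ) + 1)) ^ (-e)) N
    _ ≤ 2 / e * (max y (((0 : ℕ) : ℝ) + 1)) ^ (-e) := by
        rw [sub_le_self_iff]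
        have := (hpos N).le
        positivity
    _ ≤ 2 / e * y ^ (-e) := by
        gcongr 2 / e * ?_
        exact Real.rpow_le_rpow_of_nonpos hy (le_max_left _ _) (by linarith)

lemma add_one_rpow_inv_lt_iff {p x : ℝ} (hp : 0 < p) (hx : 0 ≤ x) (k : ℕ) :
    ((k : ℝ) + 1) ^ (1 / p) < x ↔ (k : ℝ) + 1 < x ^ p := by
  rw [one_div, Real.rpow_inv_lt_iff_of_pos (by positivity) hx hp]

/-- This and the next two sums, taken at `x = ‖Y ω‖`, control respectively the large terms, the
compensators and the centred truncated terms. -/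
lemma sum_ite_one_le {p x : ℝ} (hp : 1 < p) (hx : 0 ≤ x) (N : ℕ) :
    ∑ k ∈ Finset.range N, (if ((k : ℝ) + 1) ^ (1 / p) < x then (1 : ℝ) else 0) ≤ x ^ p := by
  have := sum_ite_rpow_sub_one_le one_pos le_rfl (Real.rpow_nonneg hx p) N
  simpa only [add_one_rpow_inv_lt_iff (by linarith : 0 < p) hx, sub_self, Real.rpow_zero,
    Real.rpow_one, div_one] using this

lemma sum_inv_mul_ite_le {p x : ℝ} (hp : 1 < p) (hx : 0 ≤ x) (N : ℕ) :
    ∑ k ∈ Finset.range N,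
      (((k : ℝ) + 1) ^ (1 / p))⁻¹ * (if ((k : ℝ) + 1) ^ (1 / p) < x then x else 0)
      ≤ p / (p - 1) * x ^ p := by
  have hp0 : 0 < p := by linarith
  have ha : 0 < 1 - 1 / p := by rw [sub_pos, div_lt_one hp0]; exact hp
  have hip : 0 < 1 / p := by positivity
  have h := mul_le_mul_of_nonneg_left
    (sum_ite_rpow_sub_one_le ha (by linarith) (Real.rpow_nonneg hx p) N) hx
  rw [Finset.mul_sum] at h
  refine (le_of_eq ?_).trans (h.trans (le_of_eq ?_))
  · refine Finset.sum_congr rfl fun k _ => ?_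
    simp only [add_one_rpow_inv_lt_iff hp0 hx]
    split_ifs
    · rw [← Real.rpow_neg (by positivity)]
      ring_nf
    · simp
  · rw [← Real.rpow_mul hx, show p * (1 - 1 / p) = p - 1 by field_simp]
    rcases hx.eq_or_lt with rfl | hx'
    · rw [Real.zero_rpow hp0.ne']; simp
    · rw [Real.rpow_sub_one hx'.ne']
      have : p - 1 ≠ 0 := by linarith
      field_simp

lemma sum_rpow_neg_mul_ite_le {p r x : ℝ} (hp : 1 < p) (hpr : p < r) (hr : r ≤ 2) (hx : 0 ≤ x)
    (N : ℕ) :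
    ∑ k ∈ Finset.range N,
      (((k : ℝ) + 1) ^ (1 / p)) ^ (-r) * (if x ≤ ((k : ℝ) + 1) ^ (1 / p) then x ^ r else 0)
      ≤ 2 * p / (r - p) * x ^ p := by
  have hp0 : 0 < p := by linarith
  have hr0 : 0 < r := by linarith
  rcases hx.eq_or_lt with rfl | hx'
  · simp [Real.zero_rpow hp0.ne', Real.zero_rpow hr0.ne']
  have he : 0 < r / p - 1 := by rw [sub_pos, lt_div_iff₀ hp0]; linarith
  have he1 : r / p - 1 ≤ 1 := by rw [sub_le_iff_le_add, div_le_iff₀ hp0]; linarith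
  have h := mul_le_mul_of_nonneg_left
    (sum_ite_rpow_neg_le he he1 (Real.rpow_pos_of_pos hx' p) N) (Real.rpow_nonneg hx r)
  rw [Finset.mul_sum] at h
  refine (le_of_eq ?_).trans (h.trans (le_of_eq ?_))
  · refine Finset.sum_congr rfl fun k _ => ?_
    have := add_one_rpow_inv_lt_iff hp0 hx k
    simp only [← not_lt, this]
    rw [← Real.rpow_mul (by positivity)]
    split_ifs
    · simp
    · rw [show -1 - (r / p - 1) = 1 / p * -r by ring]; ring
  · rw [← Real.rpow_mul hx, show p * -(r / p - 1) = p - r by field_simp; ring,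
      Real.rpow_sub hx']
    have : r - p ≠ 0 := by linarith
    have : r / p - 1 ≠ 0 := he.ne'
    have := (Real.rpow_pos_of_pos hx' r).ne'
    field_simp

lemma sum_smul_eq_sub_sum_sub_smul {E : Type w} [NormedAddCommGroup E] [NormedSpace ℝ E]
    (b : ℕ → ℝ) (v : ℕ → E) (n : ℕ) :
    ∑ k ∈ Finset.range (n + 1), b k • v k = b n • ∑ k ∈ Finset.range (n + 1), v k
      - ∑ k ∈ Finset.range n, (b (k + 1) - b k) • ∑ j ∈ Finset.range (k + 1), v j := by
  induction n with
  | zero => simp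
  | succ n ih =>
    rw [Finset.sum_range_succ, ih, Finset.sum_range_succ v (n + 1),
      Finset.sum_range_succ (fun k => (b (k + 1) - b k) • ∑ j ∈ Finset.range (k + 1), v j) n]
    module

/-- A quantitative Kronecker lemma: after Abel summation the boundary term costs `a * b n`, and the
nonnegative increments of `b` telescope to at most another `a * b n`. -/
lemma norm_sum_smul_le_of_monotone {E : Type w} [NormedAddCommGroup E] [NormedSpace ℝ E]
    {b : ℕ → ℝ} (hb : Monotone b) (hb0 : 0 ≤ b 0) {v : ℕ → E} {a : ℝ}
    (h : ∀ n, ‖∑ k ∈ Finset.range n, v k‖ ≤ a) (n : ℕ) :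
    ‖∑ k ∈ Finset.range (n + 1), b k • v k‖ ≤ 2 * a * b n := by
  have ha : 0 ≤ a := (norm_nonneg _).trans (h 0)
  have hbn : 0 ≤ b n := hb0.trans (hb n.zero_le)
  rw [sum_smul_eq_sub_sum_sub_smul]
  calc _ ≤ ‖b n • ∑ k ∈ Finset.range (n + 1), v k‖
        + ∑ k ∈ Finset.range n, ‖(b (k + 1) - b k) • ∑ j ∈ Finset.range (k + 1), v j‖ :=
        (norm_sub_le _ _).trans (by gcongr; exact norm_sum_le _ _)
    _ ≤ b n * a + ∑ k ∈ Finset.range n, (b (k + 1) - b k) * a := by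
        gcongr with k
        · rw [norm_smul, Real.norm_of_nonneg hbn]; gcongr; exact h _
        · have : 0 ≤ b (k + 1) - b k := sub_nonneg.2 (hb k.le_succ)
          rw [norm_smul, Real.norm_of_nonneg this]; gcongr; exact h _
    _ = 2 * a * b n - b 0 * a := by
        rw [← Finset.sum_mul, Finset.sum_range_sub]; ring
    _ ≤ _ := by rw [sub_le_self_iff]; positivity

/-! ### Conditional expectations and the maximal inequality in smooth spaces. -/

section General

variable {Ω : Type u} {mΩ : MeasurableSpace Ω} {μ : Measure Ω} {E : Type w}
  [NormedAddCommGroup E]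

lemma eLpNorm_ofReal_rpow {p : ℝ} (hp : 0 < p) (f : Ω → E) :
    eLpNorm f (ENNReal.ofReal p) μ ^ p = ∫⁻ ω, ‖f ω‖ₑ ^ p ∂μ := by
  rw [eLpNorm_eq_lintegral_rpow_enorm_toReal (by simpa using hp) ENNReal.ofReal_ne_top,
    ENNReal.toReal_ofReal hp.le, ← ENNReal.rpow_mul, one_div, inv_mul_cancel₀ hp.ne',
    ENNReal.rpow_one]

lemma tsum_lintegral_ofReal_norm_le {Y : Ω → E} (hY : StronglyMeasurable Y) {φ : ℕ → ℝ → ℝ}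
    (hφ : ∀ k, Measurable (φ k)) (hφ0 : ∀ k x, 0 ≤ x → 0 ≤ φ k x) {C p : ℝ} (hC : 0 ≤ C)
    (hp : 0 ≤ p) (h : ∀ N x, 0 ≤ x → ∑ k ∈ Finset.range N, φ k x ≤ C * x ^ p) :
    ∑' k, ∫⁻ ω, ENNReal.ofReal (φ k ‖Y ω‖) ∂μ ≤ ENNReal.ofReal C * ∫⁻ ω, ‖Y ω‖ₑ ^ p ∂μ := by
  refine ENNReal.tsum_le_of_sum_range_le fun N => ?_
  have hm : ∀ k, Measurable fun ω => ENNReal.ofReal (φ k ‖Y ω‖) := fun k =>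
    ((hφ k).comp hY.norm.measurable).ennreal_ofReal
  rw [← lintegral_finsetSum _ fun k _ => hm k,
    ← lintegral_const_mul' _ _ ENNReal.ofReal_ne_top]
  refine lintegral_mono fun ω => ?_
  rw [← ENNReal.ofReal_sum_of_nonneg fun k _ => hφ0 k _ (norm_nonneg _), ← ofReal_norm,
    ENNReal.ofReal_rpow_of_nonneg (norm_nonneg _) hp, ← ENNReal.ofReal_mul hC]
  exact ENNReal.ofReal_le_ofReal (h N _ (norm_nonneg _))

variable [NormedSpace ℝ E] [CompleteSpace E]

lemma lintegral_enorm_condExp_le (m : MeasurableSpace Ω) (f : Ω → E) :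
    ∫⁻ ω, ‖(μ[f | m]) ω‖ₑ ∂μ ≤ ∫⁻ ω, ‖f ω‖ₑ ∂μ := by
  simpa only [eLpNorm_one_eq_lintegral_enorm] using
    eLpNorm_condExp_le_eLpNorm (m := m) (μ := μ) f le_rfl

lemma eLpNorm_sub_condExp_le {p : ℝ≥0∞} (hp : 1 ≤ p) (m : MeasurableSpace Ω) {f : Ω → E}
    (hf : AEStronglyMeasurable[mΩ] f μ) :
    eLpNorm (f - μ[f | m]) p μ ≤ 2 * eLpNorm f p μ := by
  by_cases hm : m ≤ mΩ
  · calc _ ≤ eLpNorm f p μ + eLpNorm (μ[f | m]) p μ :=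
          eLpNorm_sub_le hf (stronglyMeasurable_condExp.mono hm).aestronglyMeasurable hp
      _ ≤ eLpNorm f p μ + eLpNorm f p μ := by gcongr; exact eLpNorm_condExp_le_eLpNorm f hp
      _ = _ := (two_mul _).symm
  · rw [condExp_of_not_le hm, sub_zero, two_mul]
    exact le_self_add

lemma lintegral_enorm_sub_condExp_rpow_le {r : ℝ} (hr : 1 ≤ r) (m : MeasurableSpace Ω)
    {f : Ω → E} (hf : AEStronglyMeasurable[mΩ] f μ) :
    ∫⁻ ω, ‖f ω - (μ[f | m]) ω‖ₑ ^ r ∂μ ≤ 2 ^ r * ∫⁻ ω, ‖f ω‖ₑ ^ r ∂μ := by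
  have hr0 : 0 < r := by linarith
  have h := ENNReal.rpow_le_rpow
    (eLpNorm_sub_condExp_le (p := ENNReal.ofReal r) (by simpa using hr) m hf) hr0.le
  rw [ENNReal.mul_rpow_of_nonneg _ _ hr0.le, eLpNorm_ofReal_rpow hr0, eLpNorm_ofReal_rpow hr0] at h
  exact h

lemma condExp_sub_condExp_self [IsFiniteMeasure μ] {m : MeasurableSpace Ω} (hm : m ≤ mΩ)
    {f : Ω → E} (hf : Integrable f μ) : μ[f - μ[f | m] | m] =ᵐ[μ] 0 := by
  filter_upwards [condExp_sub hf integrable_condExp m] with ω h1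
  rw [h1, condExp_of_stronglyMeasurable hm stronglyMeasurable_condExp integrable_condExp]
  simp

/-- The weak-type maximal inequality for martingales in a smooth space, obtained by applying the
smoothness inequality to the martingale stopped when it leaves the unit ball. -/
lemma IsSmoothSpace.measure_exists_le {r D : ℝ} (hE : IsSmoothSpace.{u, w} r D E) (hr : 0 < r)
    [IsProbabilityMeasure μ] (𝒢 : Filtration ℕ mΩ) {d : ℕ → Ω → E}
    (hd : ∀ n, StronglyMeasurable[𝒢 (n + 1)] (d n)) (hi : ∀ n, Integrable (d n) μ)
    (hz : ∀ n, μ[d n | 𝒢 n] =ᵐ[μ] 0) (N : ℕ) :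
    μ {ω | ∃ n ≤ N, 1 < ‖∑ k ∈ Finset.range n, d k ω‖}
      ≤ ENNReal.ofReal (D ^ r) * ∑ k ∈ Finset.range N, ∫⁻ ω, ‖d k ω‖ₑ ^ r ∂μ := by
  set A : ℕ → Set Ω := fun n => {ω | ∀ m ≤ n, ‖∑ k ∈ Finset.range m, d k ω‖ ≤ 1} with hA_def
  have hA : ∀ n, MeasurableSet[𝒢 n] (A n) := by
    intro n
    have : A n = ⋂ m ∈ Set.Iic n, {ω | ‖∑ k ∈ Finset.range m, d k ω‖ ≤ 1} := by
      ext ω; simp [hA_def]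
    rw [this]
    refine MeasurableSet.biInter (Set.to_countable _) fun m hm => ?_
    have h1 : StronglyMeasurable[𝒢 n] (fun ω => ∑ k ∈ Finset.range m, d k ω) :=
      Finset.stronglyMeasurable_fun_sum _ fun k hk => (hd k).mono
        (𝒢.mono (le_trans (Nat.succ_le_of_lt (Finset.mem_range.1 hk)) (Set.mem_Iic.1 hm)))
    exact measurableSet_le h1.norm.measurable measurable_const
  have key := hE Ω μ 𝒢 N (fun n => (A n).indicator (d n))
    (fun n _ => (hd n).indicator (𝒢.mono n.le_succ _ (hA n)))
    (fun n _ => (hi n).indicator (𝒢.le n _ (hA n)))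
    (fun n _ => by
      filter_upwards [condExp_indicator (hi n) (hA n), hz n] with ω h1 h2
      rw [h1, Set.indicator_apply]
      split_ifs
      · exact h2
      · rfl)
  calc _ ≤ ∫⁻ ω, ‖∑ n ∈ Finset.range N, (A n).indicator (d n) ω‖ₑ ^ r ∂μ := by
        rw [← one_mul (μ _)]
        refine (mul_le_mul_right (measure_mono ?_) _).trans
          (mul_meas_ge_le_lintegral₀ ?_ 1)
        · rintro ω ⟨n, hn, h⟩
          classical
          have hex : ∃ m, 1 < ‖∑ k ∈ Finset.range m, d k ω‖ := ⟨n, h⟩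
          have hle : Nat.find hex ≤ N := (Nat.find_min' hex h).trans hn
          -- The stopped sum is frozen at the first exit from the ball, so its value at time `N`
          -- still has norm greater than 1.
          have hsum : ∑ n ∈ Finset.range N, (A n).indicator (d n) ω
              = ∑ k ∈ Finset.range (Nat.find hex), d k ω := by
            rw [← Finset.sum_subset (Finset.range_subset_range.2 hle)]
            · refine Finset.sum_congr rfl fun k hk => ?_
              rw [Set.indicator_of_mem]
              intro m hm
              exact not_lt.1 (Nat.find_min hex (hm.trans_lt (Finset.mem_range.1 hk)))
            · intro k _ hk
              rw [Set.indicator_of_notMem]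
              intro hmem
              exact (Nat.find_spec hex).not_ge (hmem _ (by simpa using hk))
          simp only [Set.mem_ofPred_eq]
          rw [hsum]
          refine ENNReal.one_le_rpow ?_ hr
          rw [← ofReal_norm, ENNReal.one_le_ofReal]
          exact (Nat.find_spec hex).le
        · exact ((Finset.aestronglyMeasurable_fun_sum _ fun n _ =>
            ((hi n).indicator (𝒢.le n _ (hA n))).aestronglyMeasurable).enorm).pow_const _
    _ ≤ _ := key
    _ ≤ _ := by
        gcongr with k _ ω
        exact enorm_indicator_le_enorm_self _ _

lemma IsSmoothSpace.measure_exists_le_tsum {r D : ℝ} (hE : IsSmoothSpace.{u, w} r D E)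
    (hr : 0 < r) [IsProbabilityMeasure μ] (𝒢 : Filtration ℕ mΩ) {d : ℕ → Ω → E}
    (hd : ∀ n, StronglyMeasurable[𝒢 (n + 1)] (d n)) (hi : ∀ n, Integrable (d n) μ)
    (hz : ∀ n, μ[d n | 𝒢 n] =ᵐ[μ] 0) :
    μ {ω | ∃ n, 1 < ‖∑ k ∈ Finset.range n, d k ω‖}
      ≤ ENNReal.ofReal (D ^ r) * ∑' k, ∫⁻ ω, ‖d k ω‖ₑ ^ r ∂μ := by
  have hU : {ω | ∃ n, 1 < ‖∑ k ∈ Finset.range n, d k ω‖}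
      = ⋃ N : ℕ, {ω | ∃ n ≤ N, 1 < ‖∑ k ∈ Finset.range n, d k ω‖} := by
    ext ω
    simp only [Set.mem_ofPred_eq, Set.mem_iUnion]
    exact ⟨fun ⟨n, h⟩ => ⟨n, n, le_rfl, h⟩, fun ⟨_, n, _, h⟩ => ⟨n, h⟩⟩
  rw [hU, Monotone.measure_iUnion (by
    rintro N M h ω ⟨n, hn, h'⟩
    exact ⟨n, hn.trans h, h'⟩)]
  refine iSup_le fun N => (hE.measure_exists_le hr 𝒢 hd hi hz N).trans ?_
  gcongr
  exact ENNReal.sum_le_tsum _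

end General

/-! ### Weak-type estimate for stationary martingale differences. -/

/-- The constant in the level-one weak-type estimate for stationary martingale differences. -/
noncomputable def weakTypeConst (p r : ℝ) : ℝ :=
  1 + p / (p - 1) + 2 ^ r * (2 * p / (r - p))

lemma one_le_weakTypeConst {p r : ℝ} (hp : 1 < p) (hpr : p < r) : 1 ≤ weakTypeConst p r := by
  have h1 : 0 < p - 1 := by linarith
  have h2 : 0 < r - p := by linarith
  have h3 : 0 ≤ p / (p - 1) + 2 ^ r * (2 * p / (r - p)) := by positivity
  rw [weakTypeConst]
  linarith

section Stationary

variable {Ω : Type u} {mΩ : MeasurableSpace Ω} {μ : Measure Ω} [IsProbabilityMeasure μ]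
  {E : Type w} [NormedAddCommGroup E] [NormedSpace ℝ E] [CompleteSpace E]

lemma measure_exists_lt_norm_birkhoffSum_le {p r D : ℝ} (hp : 1 < p) (hpr : p < r) (hr : r ≤ 2)
    (hD : 1 ≤ D) (hE : IsSmoothSpace.{u, w} r D E) (𝒢 : Filtration ℕ mΩ) {T : Ω → Ω}
    (hT : MeasurePreserving T μ μ) {Y : Ω → E} (hY : StronglyMeasurable Y)
    (hYi : Integrable Y μ) (had : ∀ k, StronglyMeasurable[𝒢 (k + 1)] (Y ∘ T^[k]))
    (hz : ∀ k, μ[Y ∘ T^[k] | 𝒢 k] =ᵐ[μ] 0) :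
    μ {ω | ∃ n : ℕ, 3 * ((n : ℝ) + 1) ^ (1 / p) < ‖birkhoffSum T Y (n + 1) ω‖}
      ≤ ENNReal.ofReal (weakTypeConst p r * D ^ r) * ∫⁻ ω, ‖Y ω‖ₑ ^ p ∂μ := by
  have hp0 : 0 < p := by linarith
  have hr0 : 0 < r := by linarith
  have hp1 : 0 < p - 1 := by linarith
  have hrp : 0 < r - p := by linarith
  have hTk : ∀ k, MeasurePreserving T^[k] μ μ := fun k => hT.iterate k
  set b : ℕ → ℝ := fun k => ((k : ℝ) + 1) ^ (1 / p) with hb_def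
  have hb0 : ∀ k, 0 < b k := fun k => by positivity
  have hbm : Monotone b := fun k l h => by simp only [hb_def]; gcongr
  set d : ℕ → Ω → E := fun k => Y ∘ T^[k] with hd_def
  have hdi : ∀ k, Integrable (d k) μ := fun k => (hTk k).integrable_comp_of_integrable hYi
  -- The truncation acts on `Y` before composing with the `k`-th iterate, so every moment below
  -- reduces to one of `Y` by measure preservation.
  set lo : ℕ → Ω → E := fun k => {ω | ‖Y ω‖ ≤ b k}.indicator Y with hlo_def
  set hi : ℕ → Ω → E := fun k => {ω | b k < ‖Y ω‖}.indicator Y with hhi_def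
  have hlom : ∀ k, StronglyMeasurable (lo k) := fun k =>
    hY.indicator (measurableSet_le hY.norm.measurable measurable_const)
  have hhim : ∀ k, StronglyMeasurable (hi k) := fun k =>
    hY.indicator (measurableSet_lt measurable_const hY.norm.measurable)
  have hloi : ∀ k, Integrable (lo k) μ := fun k =>
    hYi.indicator (measurableSet_le hY.norm.measurable measurable_const)
  have hhii : ∀ k, Integrable (hi k) μ := fun k =>
    hYi.indicator (measurableSet_lt measurable_const hY.norm.measurable)
  set d' : ℕ → Ω → E := fun k => lo k ∘ T^[k] with hd'_def
  set d'' : ℕ → Ω → E := fun k => hi k ∘ T^[k] with hd''_def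
  have hd'i : ∀ k, Integrable (d' k) μ := fun k => (hTk k).integrable_comp_of_integrable (hloi k)
  have hd''i : ∀ k, Integrable (d'' k) μ := fun k => (hTk k).integrable_comp_of_integrable (hhii k)
  have hdd : ∀ k, d k = d' k + d'' k := by
    intro k
    ext ω
    simp only [hd_def, hd'_def, hd''_def, hlo_def, hhi_def, Function.comp_apply, Pi.add_apply,
      Set.indicator_apply, Set.mem_ofPred_eq]
    by_cases h : ‖Y (T^[k] ω)‖ ≤ b k
    · simp [h, not_lt.2 h]
    · simp [h, not_le.1 h]
  have hd'm : ∀ k, StronglyMeasurable[𝒢 (k + 1)] (d' k) := by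
    intro k
    have : d' k = {ω | ‖d k ω‖ ≤ b k}.indicator (d k) := rfl
    rw [this]
    exact (had k).indicator (measurableSet_le (had k).norm.measurable measurable_const)
  set m : ℕ → Ω → E := fun k => μ[d' k | 𝒢 k] with hm_def
  -- As `d k` has zero conditional expectation, the compensator of the small part is minus that of
  -- the large part, which is what makes it small in `L¹`.
  have hm : ∀ k, m k =ᵐ[μ] -μ[d'' k | 𝒢 k] := by
    intro k
    have h1 := condExp_add (hd'i k) (hd''i k) (𝒢 k)
    rw [← hdd k] at h1
    filter_upwards [h1, hz k] with ω h1 h2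
    have h3 : m k ω + (μ[d'' k | 𝒢 k]) ω = 0 := by
      rw [← Pi.add_apply, ← h1]; exact h2
    exact eq_neg_of_add_eq_zero_left h3
  set v : ℕ → Ω → E := fun k => (b k)⁻¹ • (d' k - m k) with hv_def
  -- the three exceptional events
  have hI1 : μ (⋃ k, {ω | b k < ‖d k ω‖}) ≤ ENNReal.ofReal 1 * ∫⁻ ω, ‖Y ω‖ₑ ^ p ∂μ := by
    refine (measure_iUnion_le _).trans ?_
    refine le_trans (le_of_eq ?_) (tsum_lintegral_ofReal_norm_le hY
      (φ := fun k x => if b k < x then 1 else 0)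
      (fun k => Measurable.ite measurableSet_Ioi measurable_const measurable_const)
      (fun k x _ => by positivity) zero_le_one hp0.le
      (fun N x hx => by rw [one_mul]; exact sum_ite_one_le hp hx N))
    congr 1
    ext k
    have hms : MeasurableSet {ω | b k < ‖Y ω‖} :=
      measurableSet_lt measurable_const hY.norm.measurable
    have : {ω | b k < ‖d k ω‖} = T^[k] ⁻¹' {ω | b k < ‖Y ω‖} := rfl
    rw [this, (hTk k).measure_preimage hms.nullMeasurableSet, ← lintegral_indicator_one hms]
    congr 1
    ext ω
    by_cases h : b k < ‖Y ω‖ <;> simp [h]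
  have hI2 : μ {ω | ∃ n, 1 < ‖∑ k ∈ Finset.range n, v k ω‖}
      ≤ ENNReal.ofReal (2 ^ r * (2 * p / (r - p)) * D ^ r) * ∫⁻ ω, ‖Y ω‖ₑ ^ p ∂μ := by
    refine (hE.measure_exists_le_tsum hr0 𝒢 (d := v) ?_ ?_ ?_).trans ?_
    · exact fun k => ((hd'm k).sub (stronglyMeasurable_condExp.mono (𝒢.mono k.le_succ))).const_smul _
    · exact fun k => ((hd'i k).sub integrable_condExp).smul _
    · intro k
      filter_upwards [condExp_smul (μ := μ) (b k)⁻¹ (d' k - m k) (𝒢 k),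
        condExp_sub_condExp_self (𝒢.le k) (hd'i k)] with ω h1 h2
      rw [h1, Pi.smul_apply, h2]
      simp
    · have hk : ∀ k, ∫⁻ ω, ‖v k ω‖ₑ ^ r ∂μ ≤ 2 ^ r * ∫⁻ ω, ENNReal.ofReal
          ((b k) ^ (-r) * (if ‖Y ω‖ ≤ b k then ‖Y ω‖ ^ r else 0)) ∂μ := by
        intro k
        calc _ = ENNReal.ofReal ((b k) ^ (-r)) * ∫⁻ ω, ‖d' k ω - m k ω‖ₑ ^ r ∂μ := by
              rw [← lintegral_const_mul' _ _ ENNReal.ofReal_ne_top]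
              congr 1
              ext ω
              simp only [hv_def, Pi.smul_apply, Pi.sub_apply]
              rw [enorm_smul, ENNReal.mul_rpow_of_nonneg _ _ hr0.le]
              congr 1
              rw [Real.enorm_of_nonneg (inv_pos.2 (hb0 k)).le,
                ENNReal.ofReal_rpow_of_pos (inv_pos.2 (hb0 k)), Real.inv_rpow (hb0 k).le,
                Real.rpow_neg (hb0 k).le]
          _ ≤ ENNReal.ofReal ((b k) ^ (-r)) * (2 ^ r * ∫⁻ ω, ‖d' k ω‖ₑ ^ r ∂μ) := by
              gcongr
              exact lintegral_enorm_sub_condExp_rpow_le (by linarith) _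
                (hd'i k).aestronglyMeasurable
          _ = ENNReal.ofReal ((b k) ^ (-r)) * (2 ^ r * ∫⁻ ω, ‖lo k ω‖ₑ ^ r ∂μ) := by
              congr 2
              exact (hTk k).lintegral_comp ((hlom k).enorm.pow_const r)
          _ = _ := by
              rw [mul_left_comm, ← lintegral_const_mul' _ _ ENNReal.ofReal_ne_top]
              congr 2
              ext ω
              rw [ENNReal.ofReal_mul (Real.rpow_nonneg (hb0 k).le _)]
              congr 1
              by_cases h : ‖Y ω‖ ≤ b k
              · simp only [hlo_def, Set.indicator_apply, Set.mem_ofPred_eq, h, if_true]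
                rw [← ofReal_norm, ENNReal.ofReal_rpow_of_nonneg (norm_nonneg _) hr0.le]
              · simp [hlo_def, h, hr0]
      calc _ ≤ ENNReal.ofReal (D ^ r) * ∑' k, 2 ^ r * ∫⁻ ω, ENNReal.ofReal
            ((b k) ^ (-r) * (if ‖Y ω‖ ≤ b k then ‖Y ω‖ ^ r else 0)) ∂μ := by
            gcongr with k
            exact hk k
        _ ≤ ENNReal.ofReal (D ^ r) * (2 ^ r * (ENNReal.ofReal (2 * p / (r - p))
              * ∫⁻ ω, ‖Y ω‖ₑ ^ p ∂μ)) := by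
            rw [ENNReal.tsum_mul_left]
            gcongr
            exact tsum_lintegral_ofReal_norm_le hY
              (φ := fun k x => (b k) ^ (-r) * (if x ≤ b k then x ^ r else 0))
              (fun k => (Measurable.ite measurableSet_Iic (measurable_id.pow_const r)
                measurable_const).const_mul _)
              (fun k x hx => by
                have := (hb0 k).le
                positivity) (by positivity) hp0.le
              (fun N x hx => sum_rpow_neg_mul_ite_le hp hpr hr hx N)
        _ = _ := by
            rw [ENNReal.ofReal_mul (by positivity), ENNReal.ofReal_mul (by positivity),
              ← ENNReal.ofReal_rpow_of_pos two_pos, ENNReal.ofReal_ofNat]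
            ring
  have hI3 : μ {ω | 1 ≤ ∑' k, ‖(b k)⁻¹ • m k ω‖ₑ}
      ≤ ENNReal.ofReal (p / (p - 1)) * ∫⁻ ω, ‖Y ω‖ₑ ^ p ∂μ := by
    have hmm : ∀ k, AEMeasurable (fun ω => ‖(b k)⁻¹ • m k ω‖ₑ) μ := fun k =>
      (((stronglyMeasurable_condExp.mono (𝒢.le k)).const_smul (b k)⁻¹).enorm).aemeasurable
    have hms : AEMeasurable (fun ω => ∑' k, ‖(b k)⁻¹ • m k ω‖ₑ) μ := AEMeasurable.tsum hmm
    have hmk := mul_meas_ge_le_lintegral₀ (μ := μ) hms 1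
    rw [one_mul, lintegral_tsum hmm] at hmk
    refine hmk.trans (le_trans (ENNReal.tsum_le_tsum fun k => ?_)
      (tsum_lintegral_ofReal_norm_le hY
      (φ := fun k x => (b k)⁻¹ * (if b k < x then x else 0))
      (fun k => (Measurable.ite measurableSet_Ioi measurable_id measurable_const).const_mul _)
      (fun k x hx => by
        have := (hb0 k).le
        positivity) (by positivity) hp0.le
      (fun N x hx => sum_inv_mul_ite_le hp hx N)))
    have hbk : (0 : ℝ) ≤ (b k)⁻¹ := (inv_pos.2 (hb0 k)).le
    calc _ = ENNReal.ofReal (b k)⁻¹ * ∫⁻ ω, ‖(μ[d'' k | 𝒢 k]) ω‖ₑ ∂μ := by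
          rw [← lintegral_const_mul' _ _ ENNReal.ofReal_ne_top]
          refine lintegral_congr_ae ?_
          filter_upwards [hm k] with ω h
          rw [h, enorm_smul, Real.enorm_of_nonneg hbk, Pi.neg_apply, enorm_neg]
      _ ≤ ENNReal.ofReal (b k)⁻¹ * ∫⁻ ω, ‖d'' k ω‖ₑ ∂μ := by
          gcongr ENNReal.ofReal (b k)⁻¹ * ?_
          exact lintegral_enorm_condExp_le _ _
      _ = ENNReal.ofReal (b k)⁻¹ * ∫⁻ ω, ‖hi k ω‖ₑ ∂μ := by
          congr 1
          exact (hTk k).lintegral_comp (hhim k).enorm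
      _ = _ := by
          rw [← lintegral_const_mul' _ _ ENNReal.ofReal_ne_top]
          congr 1
          ext ω
          rw [ENNReal.ofReal_mul hbk]
          congr 1
          by_cases h : b k < ‖Y ω‖ <;> simp [hhi_def, h]
  -- Off the three events no term is truncated, so the Birkhoff sum is the weighted sum of the `v
  -- k`, at most `2 * b n` by Abel summation, plus the compensators, at most `b n`. Hence the 3.
  have hsub : {ω | ∃ n : ℕ, 3 * b n < ‖birkhoffSum T Y (n + 1) ω‖}
      ⊆ (⋃ k, {ω | b k < ‖d k ω‖}) ∪ ({ω | 1 ≤ ∑' k, ‖(b k)⁻¹ • m k ω‖ₑ}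
        ∪ {ω | ∃ n, 1 < ‖∑ k ∈ Finset.range n, v k ω‖}) := by
    rintro ω ⟨n, hn⟩
    by_contra hcon
    simp only [Set.mem_union, Set.mem_iUnion, Set.mem_ofPred_eq, not_or, not_exists, not_lt,
      not_le] at hcon
    obtain ⟨h1, h2, h3⟩ := hcon
    have hS : birkhoffSum T Y (n + 1) ω = ∑ k ∈ Finset.range (n + 1), b k • v k ω
        + ∑ k ∈ Finset.range (n + 1), m k ω := by
      rw [birkhoffSum, ← Finset.sum_add_distrib]
      refine Finset.sum_congr rfl fun k _ => ?_
      have : Y (T^[k] ω) = d' k ω := by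
        have h := h1 k
        simp only [hd_def, Function.comp_apply] at h
        simp [hd'_def, hlo_def, h]
      simp [hv_def, this, smul_smul, mul_inv_cancel₀ (hb0 k).ne']
    have hS1 := norm_sum_smul_le_of_monotone hbm (hb0 0).le h3 n
    have hS2 : ‖∑ k ∈ Finset.range (n + 1), m k ω‖ ≤ b n := by
      rw [← ENNReal.ofReal_le_ofReal_iff (hb0 n).le, ofReal_norm]
      calc _ ≤ ∑ k ∈ Finset.range (n + 1), ‖m k ω‖ₑ := enorm_sum_le _ _
        _ ≤ ∑ k ∈ Finset.range (n + 1), ENNReal.ofReal (b n) * ‖(b k)⁻¹ • m k ω‖ₑ := by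
            refine Finset.sum_le_sum fun k hk => ?_
            calc ‖m k ω‖ₑ = ENNReal.ofReal (b k) * ‖(b k)⁻¹ • m k ω‖ₑ := by
                  rw [← Real.enorm_of_nonneg (hb0 k).le, ← enorm_smul, smul_smul,
                    mul_inv_cancel₀ (hb0 k).ne', one_smul]
              _ ≤ _ := by
                  gcongr
                  exact hbm (Nat.lt_succ_iff.1 (Finset.mem_range.1 hk))
        _ ≤ ENNReal.ofReal (b n) * 1 := by
            rw [← Finset.mul_sum]
            gcongr
            exact (ENNReal.sum_le_tsum _).trans h2.le
        _ = _ := mul_one _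
    have := norm_add_le (∑ k ∈ Finset.range (n + 1), b k • v k ω)
      (∑ k ∈ Finset.range (n + 1), m k ω)
    rw [← hS] at this
    linarith
  -- Only the smoothness term carries `D ^ r`; `D ≥ 1` lets this factor absorb the other two.
  have hDr : 1 ≤ D ^ r := Real.one_le_rpow hD hr0.le
  calc _ ≤ μ (⋃ k, {ω | b k < ‖d k ω‖}) + (μ {ω | 1 ≤ ∑' k, ‖(b k)⁻¹ • m k ω‖ₑ}
        + μ {ω | ∃ n, 1 < ‖∑ k ∈ Finset.range n, v k ω‖}) :=
        (measure_mono hsub).trans ((measure_union_le _ _).trans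
          (by gcongr; exact measure_union_le _ _))
    _ ≤ _ := add_le_add hI1 (add_le_add hI3 hI2)
    _ = ENNReal.ofReal (1 + (p / (p - 1) + 2 ^ r * (2 * p / (r - p)) * D ^ r))
          * ∫⁻ ω, ‖Y ω‖ₑ ^ p ∂μ := by
        rw [ENNReal.ofReal_add (p := 1) (by positivity) (by positivity),
          ENNReal.ofReal_add (by positivity) (by positivity)]
        ring
    _ ≤ _ := by
        gcongr
        rw [weakTypeConst]
        have : 0 ≤ p / (p - 1) := by positivity
        nlinarith

/-- Homogeneity: the level-one estimate is applied to `(3 / t) • Y`. -/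
lemma rpow_mul_measure_lt_mzMaximal_le {p r D : ℝ} (hp : 1 < p) (hpr : p < r) (hr : r ≤ 2)
    (hD : 1 ≤ D) (hE : IsSmoothSpace.{u, w} r D E) (𝒢 : Filtration ℕ mΩ) {T : Ω → Ω}
    (hT : MeasurePreserving T μ μ) {Y : Ω → E} (hY : StronglyMeasurable Y)
    (hYi : Integrable Y μ) (had : ∀ k, StronglyMeasurable[𝒢 (k + 1)] (Y ∘ T^[k]))
    (hz : ∀ k, μ[Y ∘ T^[k] | 𝒢 k] =ᵐ[μ] 0) {t : ℝ} (ht : 0 < t) :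
    ENNReal.ofReal t ^ p * μ {ω | ENNReal.ofReal t < mzMaximal T p Y ω}
      ≤ ENNReal.ofReal (3 ^ p * weakTypeConst p r * D ^ r) * ∫⁻ ω, ‖Y ω‖ₑ ^ p ∂μ := by
  have hp0 : 0 < p := by linarith
  have hc := one_le_weakTypeConst hp hpr
  have hc3 : 0 < 3 / t := by positivity
  have key := measure_exists_lt_norm_birkhoffSum_le hp hpr hr hD hE 𝒢 hT
    (hY.const_smul (3 / t)) (hYi.smul (3 / t)) (fun k => (had k).const_smul (3 / t))
    (fun k => by
      filter_upwards [condExp_smul (μ := μ) (3 / t) (Y ∘ T^[k]) (𝒢 k), hz k] with ω h1 h2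
      rw [show ((3 / t) • Y) ∘ T^[k] = (3 / t) • (Y ∘ T^[k]) from rfl, h1, Pi.smul_apply, h2]
      simp)
  have hsub : {ω | ENNReal.ofReal t < mzMaximal T p Y ω} ⊆
      {ω | ∃ n : ℕ, 3 * ((n : ℝ) + 1) ^ (1 / p) < ‖birkhoffSum T ((3 / t) • Y) (n + 1) ω‖} := by
    intro ω h
    simp only [mzMaximal, Set.mem_ofPred_eq, lt_iSup_iff] at h
    obtain ⟨n, hn, h⟩ := h
    obtain ⟨n, rfl⟩ := Nat.exists_eq_succ_of_ne_zero (by omega : n ≠ 0)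
    refine ⟨n, ?_⟩
    have hb : 0 < ((n : ℝ) + 1) ^ (1 / p) := by positivity
    have hcast : ((n.succ : ℕ) : ℝ≥0∞) ^ (1 / p) = ENNReal.ofReal (((n : ℝ) + 1) ^ (1 / p)) := by
      rw [← ENNReal.ofReal_rpow_of_pos (by positivity)]
      congr 1
      rw [← Nat.cast_succ, ENNReal.ofReal_natCast]
    rw [hcast, ENNReal.lt_div_iff_mul_lt (by simp) (by simp),
      ← ENNReal.ofReal_mul ht.le, ← ofReal_norm,
      ENNReal.ofReal_lt_ofReal_iff_of_nonneg (by positivity)] at h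
    have hs : birkhoffSum T ((3 / t) • Y) (n + 1) ω = (3 / t) • birkhoffSum T Y (n + 1) ω := by
      simp [birkhoffSum, Finset.smul_sum]
    rw [hs, norm_smul, Real.norm_of_nonneg hc3.le, div_mul_eq_mul_div, lt_div_iff₀ ht]
    nlinarith
  calc _ ≤ ENNReal.ofReal t ^ p * (ENNReal.ofReal (weakTypeConst p r * D ^ r) *
        ∫⁻ ω, ‖((3 / t) • Y) ω‖ₑ ^ p ∂μ) := by
        gcongr
        exact (measure_mono hsub).trans key
    _ = ENNReal.ofReal t ^ p * (ENNReal.ofReal (weakTypeConst p r * D ^ r) *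
        (ENNReal.ofReal (3 / t) ^ p * ∫⁻ ω, ‖Y ω‖ₑ ^ p ∂μ)) := by
        rw [← lintegral_const_mul' (ENNReal.ofReal (3 / t) ^ p) _ (by simp [hp0.le])]
        congr 2
        refine lintegral_congr fun ω => ?_
        rw [Pi.smul_apply, enorm_smul, ENNReal.mul_rpow_of_nonneg _ _ hp0.le,
          Real.enorm_of_nonneg hc3.le]
    _ = _ := by
        have hD0 : 0 < D := by linarith
        have : ENNReal.ofReal t ^ p * ENNReal.ofReal (3 / t) ^ p = ENNReal.ofReal (3 ^ p) := by
          rw [← ENNReal.mul_rpow_of_nonneg _ _ hp0.le, ← ENNReal.ofReal_mul ht.le,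
            mul_div_cancel₀ _ ht.ne', ENNReal.ofReal_rpow_of_pos (by norm_num)]
        rw [mul_assoc (3 ^ p : ℝ), ENNReal.ofReal_mul (p := 3 ^ p) (by positivity), ← this]
        ring

end Stationary

/-! ### A countable triangle inequality in weak `L^p`. -/

section WeakSum

variable {Ω : Type u} {mΩ : MeasurableSpace Ω} {μ : Measure Ω}

/-- The constant in the countable triangle inequality for weak `L^p`, up to a factor `2 ^ p`. -/
noncomputable def weakSumConst (p : ℝ) : ℝ≥0∞ := 2 * (1 - 2 ^ (1 - p))⁻¹

lemma weakSumConst_ne_top {p : ℝ} (hp : 1 < p) : weakSumConst p ≠ ∞ := by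
  refine ENNReal.mul_ne_top (by simp) (ENNReal.inv_ne_top.2 ?_)
  refine (tsub_pos_of_lt ?_).ne'
  exact ENNReal.rpow_lt_one_of_one_lt_of_neg (by norm_num) (by linarith)

/-- For finite `x` the dyadic block containing it already dominates; for `x = ∞` every block
contributes at least `s`, so the sum diverges. -/
lemma indicator_lt_le_tsum_dyadic {s : ℝ≥0∞} (hs : s ≠ 0) (x : ℝ≥0∞) :
    (if s < x then x else 0) ≤ ∑' j : ℕ, if 2 ^ j * s < x then 2 ^ (j + 1) * s else 0 := by
  split_ifs with hx
  · by_cases h : ∀ j : ℕ, 2 ^ j * s < x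
    · simp only [h, if_true]
      refine le_top.trans (le_of_eq (Eq.symm ?_))
      rw [← top_le_iff, ← ENNReal.tsum_const_eq_top_of_ne_zero (α := ℕ) hs]
      refine ENNReal.tsum_le_tsum fun j => ?_
      exact le_mul_of_one_le_left' (one_le_pow₀ (by norm_num))
    · push Not at h
      classical
      have h0 : Nat.find h ≠ 0 := by
        intro h0
        have := Nat.find_spec h
        rw [h0, pow_zero, one_mul] at this
        exact this.not_gt hx
      obtain ⟨j, hj⟩ := Nat.exists_eq_succ_of_ne_zero h0
      have h1 : 2 ^ j * s < x := not_le.1 (Nat.find_min h (by omega : j < Nat.find h))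
      have h2 : x ≤ 2 ^ (j + 1) * s := by
        have := Nat.find_spec h
        rwa [hj] at this
      refine le_trans ?_ (ENNReal.le_tsum j)
      rw [if_pos h1]
      exact h2
  · exact zero_le

/-- A weak `L^p` bound makes the dyadic blocks above `s` decay geometrically with ratio `2 ^ (1 -
p)`, which is less than 1 when `p > 1`. -/
lemma lintegral_ite_lt_le {g : Ω → ℝ≥0∞} (hg : Measurable g) {p : ℝ} {a s : ℝ≥0∞}
    (hs0 : s ≠ 0) (hs : s ≠ ∞) (h : ∀ t, t ≠ 0 → t ≠ ∞ → t ^ p * μ {ω | t < g ω} ≤ a) :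
    ∫⁻ ω, (if s < g ω then g ω else 0) ∂μ ≤ weakSumConst p * a * (s⁻¹) ^ (p - 1) := by
  have hms : ∀ t : ℝ≥0∞, MeasurableSet {ω | t < g ω} := fun t =>
    measurableSet_lt measurable_const hg
  calc _ ≤ ∫⁻ ω, ∑' j : ℕ, (if 2 ^ j * s < g ω then 2 ^ (j + 1) * s else 0) ∂μ :=
        lintegral_mono fun ω => indicator_lt_le_tsum_dyadic hs0 (g ω)
    _ = ∑' j : ℕ, 2 ^ (j + 1) * s * μ {ω | 2 ^ j * s < g ω} := by
        rw [lintegral_tsum fun j =>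
          (Measurable.ite (hms _) measurable_const measurable_const).aemeasurable]
        refine tsum_congr fun j => ?_
        rw [← lintegral_indicator_const (hms _)]
        simp [Set.indicator_apply]
    _ ≤ ∑' j : ℕ, 2 * a * (s⁻¹) ^ (p - 1) * (2 ^ (1 - p)) ^ j := by
        refine ENNReal.tsum_le_tsum fun j => ?_
        set t : ℝ≥0∞ := 2 ^ j * s with ht_def
        have ht0 : t ≠ 0 := mul_ne_zero (by positivity) hs0
        have ht : t ≠ ∞ := ENNReal.mul_ne_top (by simp) hs
        have h1 : μ {ω | t < g ω} ≤ a * t ^ (-p) := by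
          rw [ENNReal.rpow_neg, ← div_eq_mul_inv, ENNReal.le_div_iff_mul_le
            (Or.inl (by simp [ht0, ht])) (Or.inl (by simp [ht0, ht])), mul_comm]
          exact h t ht0 ht
        calc _ ≤ 2 ^ (j + 1) * s * (a * t ^ (-p)) := by gcongr
          _ = 2 * a * (t * t ^ (-p)) := by rw [ht_def, pow_succ]; ring
          _ = 2 * a * t ^ (1 - p) := by
              rw [sub_eq_add_neg, ENNReal.rpow_add _ _ ht0 ht, ENNReal.rpow_one]
          _ = _ := by
              rw [ht_def, ENNReal.mul_rpow_of_ne_top (by simp) hs, ← ENNReal.rpow_natCast 2 j,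
                ← ENNReal.rpow_mul, mul_comm (j : ℝ), ENNReal.rpow_mul, ENNReal.rpow_natCast,
                ENNReal.inv_rpow, ← ENNReal.rpow_neg, neg_sub]
              ring
    _ = _ := by
        rw [ENNReal.tsum_mul_left, ENNReal.tsum_geometric, weakSumConst]
        ring

/-- With `t = 2 * u`, cut `g i` at the level `s i = u * x i / A`. These levels add up to at most
`u`, so the parts above them must contribute `u`, and Markov's inequality applies. This choice makes
the tail integral proportional to `x i ^ p * x i ^ (1 - p) = x i`, hence summable. -/
lemma rpow_mul_measure_lt_tsum_le {ι : Type*} [Countable ι] {g : ι → Ω → ℝ≥0∞}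
    (hg : ∀ i, Measurable (g i)) {p : ℝ} (hp : 1 < p) {K : ℝ≥0∞} {x : ι → ℝ≥0∞}
    (hx : ∑' i, x i ≠ ∞)
    (h : ∀ i t, t ≠ 0 → t ≠ ∞ → t ^ p * μ {ω | t < g i ω} ≤ K * x i ^ p)
    {t : ℝ≥0∞} (ht0 : t ≠ 0) (ht : t ≠ ∞) :
    t ^ p * μ {ω | t < ∑' i, g i ω} ≤ 2 ^ p * weakSumConst p * K * (∑' i, x i) ^ p := by
  have hp0 : 0 < p := by linarith
  set A := ∑' i, x i with hA_def
  obtain ⟨u, hu0, hu, rfl⟩ : ∃ u : ℝ≥0∞, u ≠ 0 ∧ u ≠ ∞ ∧ t = 2 * u :=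
    ⟨t / 2, by simp [ht0], by simp [ENNReal.div_eq_top, ht],
      (ENNReal.mul_div_cancel (by simp) (by simp)).symm⟩
  have hxA : ∀ i, x i ≤ A := fun i => ENNReal.le_tsum i
  set s : ι → ℝ≥0∞ := fun i => u * (x i / A) with hs_def
  have hsum : ∑' i, s i ≤ u := by
    rw [ENNReal.tsum_mul_left]
    simp_rw [div_eq_mul_inv]
    rw [ENNReal.tsum_mul_right]
    exact mul_le_of_le_one_right' (ENNReal.mul_inv_le_one A)
  have hint : ∀ i, ∫⁻ ω, (if s i < g i ω then g i ω else 0) ∂μ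
      ≤ weakSumConst p * K * (A / u) ^ (p - 1) * x i := by
    intro i
    -- Here the cut level is zero and the tail estimate is unavailable, but the hypothesis forces `g
    -- i = 0` almost everywhere.
    by_cases hxi : x i = 0
    · have hgi : ∀ᵐ ω ∂μ, g i ω = 0 := by
        have : {ω | ¬ g i ω = 0} ⊆ ⋃ n : ℕ, {ω | ((n : ℝ≥0∞) + 1)⁻¹ < g i ω} := by
          intro ω hω
          obtain ⟨n, hn⟩ := ENNReal.exists_inv_nat_lt hω
          exact Set.mem_iUnion.2 ⟨n, lt_of_le_of_lt (ENNReal.inv_le_inv.2 le_self_add) hn⟩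
        refine measure_mono_null this (measure_iUnion_null fun n => ?_)
        have h1 := h i ((n : ℝ≥0∞) + 1)⁻¹ (by simp) (by simp)
        rw [hxi, ENNReal.zero_rpow_of_pos hp0, mul_zero, nonpos_iff_eq_zero, mul_eq_zero] at h1
        refine h1.resolve_left ?_
        simp
      rw [lintegral_congr_ae (g := fun _ => 0) (by filter_upwards [hgi] with ω h; simp [h])]
      simp
    · have hA0 : A ≠ 0 := fun h0 => hxi (le_antisymm (h0 ▸ hxA i) zero_le)
      have hxt : x i ≠ ∞ := ne_top_of_le_ne_top hx (hxA i)
      refine (lintegral_ite_lt_le (hg i) (a := K * x i ^ p)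
        (mul_ne_zero hu0 (ENNReal.div_ne_zero.2 ⟨hxi, hx⟩))
        (ENNReal.mul_ne_top hu (ENNReal.div_ne_top hxt hA0)) (h i)).trans (le_of_eq ?_)
      have h1 : (u * (x i / A))⁻¹ = (A / u) * (x i)⁻¹ := by
        rw [ENNReal.mul_inv (Or.inl hu0) (Or.inl hu), ENNReal.inv_div (Or.inl hx) (Or.inl hA0),
          div_eq_mul_inv, div_eq_mul_inv]
        ring
      have h2 : x i ^ p * ((x i)⁻¹) ^ (p - 1) = x i := by
        rw [ENNReal.inv_rpow, ← ENNReal.rpow_neg, ← ENNReal.rpow_add _ _ hxi hxt]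
        simp
      rw [h1, ENNReal.mul_rpow_of_nonneg _ _ (by linarith)]
      calc _ = weakSumConst p * K * (A / u) ^ (p - 1) * (x i ^ p * ((x i)⁻¹) ^ (p - 1)) := by ring
        _ = _ := by rw [h2]
  have hms : ∀ i, Measurable fun ω => if s i < g i ω then g i ω else 0 := fun i =>
    Measurable.ite (measurableSet_lt measurable_const (hg i)) (hg i) measurable_const
  have hmark : u * μ {ω | 2 * u < ∑' i, g i ω} ≤ weakSumConst p * K * (A / u) ^ (p - 1) * A := by
    calc _ ≤ u * μ {ω | u ≤ ∑' i, if s i < g i ω then g i ω else 0} := by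
          gcongr u * ?_
          refine measure_mono fun ω hω => ?_
          simp only [Set.mem_ofPred_eq] at hω ⊢
          by_contra hcon
          have h1 : ∑' i, g i ω ≤ ∑' i, (s i + if s i < g i ω then g i ω else 0) := by
            refine ENNReal.tsum_le_tsum fun i => ?_
            split_ifs with hi
            · exact le_add_self
            · simpa using hi
          rw [ENNReal.tsum_add] at h1
          have h2 := h1.trans (add_le_add hsum (not_le.1 hcon).le)
          rw [← two_mul] at h2
          exact h2.not_gt hω
      _ ≤ ∫⁻ ω, ∑' i, (if s i < g i ω then g i ω else 0) ∂μ :=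
          mul_meas_ge_le_lintegral₀ (Measurable.tsum hms).aemeasurable u
      _ ≤ _ := by
          rw [lintegral_tsum fun i => (hms i).aemeasurable, hA_def, ← ENNReal.tsum_mul_left]
          exact ENNReal.tsum_le_tsum hint
  have hup : u ^ p = u ^ (p - 1) * u := by
    conv_rhs => rw [← ENNReal.rpow_one u, ← ENNReal.rpow_mul, one_mul]
    rw [← ENNReal.rpow_add _ _ hu0 hu]
    simp
  have hAp : A ^ (p - 1) * A = A ^ p := by
    nth_rw 2 [← ENNReal.rpow_one A]
    rw [← ENNReal.rpow_add_of_nonneg _ _ (by linarith) zero_le_one]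
    simp
  rw [ENNReal.mul_rpow_of_nonneg _ _ hp0.le, hup]
  calc _ = 2 ^ p * u ^ (p - 1) * (u * μ {ω | 2 * u < ∑' i, g i ω}) := by ring
    _ ≤ 2 ^ p * u ^ (p - 1) * (weakSumConst p * K * (A / u) ^ (p - 1) * A) := by gcongr
    _ = 2 ^ p * weakSumConst p * K * ((u * (A / u)) ^ (p - 1) * A) := by
        rw [ENNReal.mul_rpow_of_nonneg _ _ (by linarith)]; ring
    _ = _ := by rw [ENNReal.mul_div_cancel hu0 hu, hAp]

end WeakSum

/-! ### The shifted σ-algebras and the increments `P n X`. -/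

section Shift

/-- Members of the pulled-back σ-algebra are preimages of sets `s` in `m`, and by measure
preservation the integral of `f ∘ T` over such a preimage is that of `f` over `s`, which vanishes.
-/
lemma condExp_comp_comap_eq_zero {Ω : Type u} {m mΩ : MeasurableSpace Ω} {μ : Measure Ω}
    [IsFiniteMeasure μ] {E : Type w} [NormedAddCommGroup E] [NormedSpace ℝ E] [CompleteSpace E] (hm : m ≤ mΩ)
    {T : Ω → Ω} (hT : MeasurePreserving T μ μ) (hTe : MeasurableEmbedding T) {f : Ω → E}
    (hf : Integrable f μ) (h : μ[f | m] =ᵐ[μ] 0) : μ[f ∘ T | m.comap T] =ᵐ[μ] 0 := by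
  have hle : m.comap T ≤ mΩ := (MeasurableSpace.comap_mono hm).trans hT.measurable.comap_le
  refine (ae_eq_condExp_of_forall_setIntegral_eq hle (hT.integrable_comp_of_integrable hf)
    (fun s _ _ => integrableOn_zero) ?_ aestronglyMeasurable_zero).symm
  rintro _ ⟨s, hs, rfl⟩ -
  have h1 : ∫ ω in T ⁻¹' s, (f ∘ T) ω ∂μ = ∫ ω in s, f ω ∂μ :=
    hT.setIntegral_preimage_emb hTe f s
  rw [h1, ← setIntegral_condExp hm hf hs, setIntegral_congr_ae (g := 0) (hm _ hs)
    (by filter_upwards [h] with ω h _; exact h)]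
  simp

variable {Ω : Type u} {F₀ : MeasurableSpace Ω} [mΩ : MeasurableSpace Ω] {μ : Measure Ω}
  {θ : Ω ≃ᵐ Ω} {E : Type w} [NormedAddCommGroup E]

lemma measurable_toEquiv_zpow (n : ℤ) :
    Measurable ((θ.toEquiv : Equiv.Perm Ω) ^ n : Equiv.Perm Ω) := by
  rcases n with n | n
  · rw [Int.ofNat_eq_natCast, zpow_natCast, ← Equiv.Perm.iterate_eq_pow]
    exact θ.measurable.iterate n
  · rw [zpow_negSucc, ← inv_pow, ← Equiv.Perm.iterate_eq_pow]
    exact θ.symm.measurable.iterate (n + 1)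

lemma shiftAlgebra_le (hF : F₀ ≤ mΩ) (n : ℤ) : shiftAlgebra F₀ θ n ≤ mΩ :=
  (MeasurableSpace.comap_mono hF).trans (measurable_toEquiv_zpow n).comap_le

lemma monotone_shiftAlgebra (hF : F₀ ≤ F₀.comap θ) : Monotone (shiftAlgebra F₀ θ) := by
  refine monotone_int_of_le_succ fun n => ?_
  have : shiftAlgebra F₀ θ (n + 1)
      = (F₀.comap θ).comap ((θ.toEquiv : Equiv.Perm Ω) ^ n : Equiv.Perm Ω) := by
    rw [shiftAlgebra, MeasurableSpace.comap_comp, add_comm, zpow_one_add]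
    rfl
  rw [this]
  exact MeasurableSpace.comap_mono hF

lemma shiftAlgebra_add_natCast (n : ℤ) (k : ℕ) :
    shiftAlgebra F₀ θ (n + k) = (shiftAlgebra F₀ θ n).comap θ^[k] := by
  rw [shiftAlgebra, shiftAlgebra, MeasurableSpace.comap_comp, zpow_add, zpow_natCast]
  congr 1

variable [NormedSpace ℝ E] [CompleteSpace E]

lemma stronglyMeasurable_projDiff (hF : F₀ ≤ F₀.comap θ) (n : ℤ) (X : Ω → E) :
    StronglyMeasurable[shiftAlgebra F₀ θ n] (projDiff F₀ μ θ n X) :=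
  stronglyMeasurable_condExp.sub
    (stronglyMeasurable_condExp.mono (monotone_shiftAlgebra hF (by omega)))

lemma integrable_projDiff (n : ℤ) (X : Ω → E) : Integrable (projDiff F₀ μ θ n X) μ :=
  integrable_condExp.sub integrable_condExp

lemma condExp_projDiff [IsFiniteMeasure μ] (hF₀ : F₀ ≤ mΩ) (hF : F₀ ≤ F₀.comap θ) (n : ℤ)
    (X : Ω → E) : μ[projDiff F₀ μ θ n X | shiftAlgebra F₀ θ (n - 1)] =ᵐ[μ] 0 := by
  have hle : shiftAlgebra F₀ θ (n - 1) ≤ mΩ := shiftAlgebra_le hF₀ _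
  filter_upwards [condExp_sub (integrable_condExp (μ := μ) (m := shiftAlgebra F₀ θ n) (f := X))
    (integrable_condExp (m := shiftAlgebra F₀ θ (n - 1)) (f := X)) (shiftAlgebra F₀ θ (n - 1)),
    condExp_condExp_of_le (μ := μ) (f := X) (monotone_shiftAlgebra hF (by omega : n - 1 ≤ n))
      (shiftAlgebra_le hF₀ n)] with ω h1 h2
  rw [projDiff, h1, Pi.sub_apply, h2,
    condExp_of_stronglyMeasurable hle stronglyMeasurable_condExp integrable_condExp]
  simp

/-- The filtration `k ↦ ℱ (n - 1 + k)`. -/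
def shiftFiltration (hF₀ : F₀ ≤ mΩ) (hF : F₀ ≤ F₀.comap θ) (n : ℤ) : Filtration ℕ mΩ where
  seq k := shiftAlgebra F₀ θ (n - 1 + k)
  mono' k l h := monotone_shiftAlgebra hF (by simpa using h)
  le' k := shiftAlgebra_le hF₀ _

lemma rpow_mul_measure_lt_mzMaximal_shift_le [IsProbabilityMeasure μ] {p r D : ℝ} (hp : 1 < p)
    (hpr : p < r) (hr : r ≤ 2) (hD : 1 ≤ D) (hE : IsSmoothSpace.{u, w} r D E)
    (hθ : MeasurePreserving θ μ μ) (hF₀ : F₀ ≤ mΩ) (hF : F₀ ≤ F₀.comap θ) {n : ℤ} {Y : Ω → E}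
    (hY : StronglyMeasurable[shiftAlgebra F₀ θ n] Y) (hYi : Integrable Y μ)
    (hz : μ[Y | shiftAlgebra F₀ θ (n - 1)] =ᵐ[μ] 0) {t : ℝ≥0∞} (ht0 : t ≠ 0) (ht : t ≠ ∞) :
    t ^ p * μ {ω | t < mzMaximal θ p Y ω}
      ≤ ENNReal.ofReal (3 ^ p * weakTypeConst p r * D ^ r)
        * eLpNorm Y (ENNReal.ofReal p) μ ^ p := by
  have hemb : ∀ k : ℕ, MeasurableEmbedding (θ : Ω → Ω)^[k] := by
    intro k
    induction k with
    | zero => exact MeasurableEmbedding.id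
    | succ k ih => exact ih.comp θ.measurableEmbedding
  rw [eLpNorm_ofReal_rpow (by linarith), ← ENNReal.ofReal_toReal ht]
  refine rpow_mul_measure_lt_mzMaximal_le hp hpr hr hD hE (shiftFiltration hF₀ hF n) hθ
    (hY.mono (shiftAlgebra_le hF₀ n)) hYi (fun k => ?_) (fun k => ?_) (ENNReal.toReal_pos ht0 ht)
  · have h1 : shiftFiltration hF₀ hF n (k + 1) = (shiftAlgebra F₀ θ n).comap θ^[k] := by
      rw [← shiftAlgebra_add_natCast]
      change shiftAlgebra F₀ θ (n - 1 + ((k + 1 : ℕ) : ℤ)) = _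
      congr 1
      push_cast
      ring
    rw [h1]
    exact hY.comp_measurable (comap_measurable _)
  · have h1 : shiftFiltration hF₀ hF n k = (shiftAlgebra F₀ θ (n - 1)).comap θ^[k] :=
      shiftAlgebra_add_natCast _ _
    rw [h1]
    exact condExp_comp_comap_eq_zero (shiftAlgebra_le hF₀ _) (hθ.iterate k) (hemb k) hYi hz

end Shift

/-! ### Decomposition of a regular variable into its increments. -/

section Regular

variable {Ω : Type u} {mΩ : MeasurableSpace Ω} {μ : Measure Ω}
  {E : Type w} [NormedAddCommGroup E]

/-- The limit, including the default value of `limUnder`, depends only on the tail of the sequence,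
and a late enough tail is measurable for any given `𝓕 n`. -/
lemma stronglyMeasurable_limUnder_iInf [CompleteSpace E] [SecondCountableTopology E]
    {𝓕 : ℤ → MeasurableSpace Ω} (h𝓕 : Monotone 𝓕) {c : ℕ → Ω → E}
    (hc : ∀ N : ℕ, StronglyMeasurable[𝓕 (-N)] (c N)) :
    StronglyMeasurable[⨅ n, 𝓕 n] (fun ω => limUnder atTop (fun N => c N ω)) := by
  borelize E
  have key : ∀ n, Measurable[𝓕 n] (fun ω => limUnder atTop (fun N => c N ω)) := by
    intro n
    have heq : (fun ω => limUnder atTop (fun N => c N ω))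
        = fun ω => limUnder atTop (fun N => c (N + n.natAbs) ω) := by
      funext ω
      unfold limUnder
      conv_lhs => rw [← map_add_atTop_eq_nat n.natAbs, map_map]
      rfl
    rw [heq]
    have h1 : ∀ N : ℕ, StronglyMeasurable[𝓕 n] (c (N + n.natAbs)) := fun N =>
      (hc _).mono (h𝓕 (by rw [Nat.cast_add]; omega))
    have h2 : StronglyMeasurable[𝓕 n] (fun ω => limUnder atTop (fun N => c (N + n.natAbs) ω)) :=
      @StronglyMeasurable.limUnder _ _ _ (𝓕 n) _ _ _ _ _ _ _ h1
    exact h2.measurable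
  have h : Measurable[⨅ n, 𝓕 n] (fun ω => limUnder atTop (fun N => c N ω)) := fun s hs =>
    MeasurableSpace.measurableSet_iInf.2 fun n => key n hs
  exact h.stronglyMeasurable

variable [NormedSpace ℝ E]

lemma setIntegral_eq_of_iSup {𝓕 : ℤ → MeasurableSpace Ω} (h𝓕 : Monotone 𝓕)
    (hle : ∀ n, 𝓕 n ≤ mΩ) {f g : Ω → E} (hf : Integrable f μ) (hg : Integrable g μ)
    (h : ∀ n s, MeasurableSet[𝓕 n] s → ∫ ω in s, f ω ∂μ = ∫ ω in s, g ω ∂μ) {s : Set Ω}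
    (hs : MeasurableSet[⨆ n, 𝓕 n] s) : ∫ ω in s, f ω ∂μ = ∫ ω in s, g ω ∂μ := by
  have hsup : ⨆ n, 𝓕 n ≤ mΩ := iSup_le hle
  have hpi : IsPiSystem {s | ∃ n, MeasurableSet[𝓕 n] s} := by
    rw [Set.ofPred_exists]
    exact isPiSystem_iUnion_of_monotone _ (fun n => (𝓕 n).isPiSystem_measurableSet)
      fun _ _ h => h𝓕 h
  induction s, hs
    using MeasurableSpace.induction_on_inter (MeasurableSpace.measurableSpace_iSup_eq 𝓕) hpi with
  | empty => simp
  | basic s hs => exact hs.elim fun n hn => h n s hn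
  | compl s hs ih =>
    rw [setIntegral_compl (hsup _ hs) hf, setIntegral_compl (hsup _ hs) hg, ih]
    simpa using h 0 Set.univ MeasurableSet.univ
  | iUnion A hd hA ih =>
    rw [integral_iUnion (fun n => hsup _ (hA n)) hd hf.integrableOn,
      integral_iUnion (fun n => hsup _ (hA n)) hd hg.integrableOn]
    exact tsum_congr ih

/-- If the martingale increments of `X` along a two-sided filtration are summable in `L¹`, and `X`
is regular, then `X` is almost surely the sum of its increments. -/
lemma hasSum_condExp_sub_condExp [IsFiniteMeasure μ] [CompleteSpace E] [SecondCountableTopology E] {𝓕 : ℤ → MeasurableSpace Ω}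
    (h𝓕 : Monotone 𝓕) (hle : ∀ n, 𝓕 n ≤ mΩ) {X : Ω → E} (hX : Integrable X μ)
    (hinf : μ[X | ⨅ n, 𝓕 n] =ᵐ[μ] 0) (hsup : X =ᵐ[μ] μ[X | ⨆ n, 𝓕 n])
    (hsum : ∑' n, ∫⁻ ω, ‖(μ[X | 𝓕 n] - μ[X | 𝓕 (n - 1)]) ω‖ₑ ∂μ ≠ ∞) :
    ∀ᵐ ω ∂μ, HasSum (fun n => (μ[X | 𝓕 n] - μ[X | 𝓕 (n - 1)]) ω) (X ω) := by
  set e : ℤ → Ω → E := fun n => μ[X | 𝓕 n] with he_def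
  set P : ℤ → Ω → E := fun n => e n - e (n - 1) with hP_def
  have hem : ∀ n, StronglyMeasurable[𝓕 n] (e n) := fun n => stronglyMeasurable_condExp
  have hem' : ∀ n, StronglyMeasurable (e n) := fun n => (hem n).mono (hle n)
  have hei : ∀ n, Integrable (e n) μ := fun n => integrable_condExp
  have hPm : ∀ n, Measurable (fun ω => ‖P n ω‖ₑ) := fun n => ((hem' n).sub (hem' (n - 1))).enorm
  have heint : ∀ n s, MeasurableSet[𝓕 n] s → ∫ ω in s, e n ω ∂μ = ∫ ω in s, X ω ∂μ :=
    fun n s hs => setIntegral_condExp (hle n) hX hs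
  have htop : ∫⁻ ω, (‖e (-1) ω‖ₑ + ∑' n, ‖P n ω‖ₑ) ∂μ ≠ ∞ := by
    rw [lintegral_add_left (hem' (-1)).enorm, lintegral_tsum fun n => (hPm n).aemeasurable]
    exact ENNReal.add_ne_top.2 ⟨(hei (-1)).2.ne, hsum⟩
  have hGm : Measurable fun ω => ‖e (-1) ω‖ₑ + ∑' n, ‖P n ω‖ₑ :=
    (hem' (-1)).enorm.add (Measurable.tsum hPm)
  have hGi := integrable_toReal_of_lintegral_ne_top hGm.aemeasurable htop
  have hGfin : ∀ᵐ ω ∂μ, ‖e (-1) ω‖ₑ + ∑' n, ‖P n ω‖ₑ < ∞ := ae_lt_top hGm htop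
  -- Both sequences start at `e (-1)`, so their increments split `ℤ` into `k` and `-(k + 1)` for
  -- natural `k`.
  set a : ℕ → Ω → E := fun N => e (N - 1) with ha_def
  set c : ℕ → Ω → E := fun N => e (-N - 1) with hc_def
  have ha : ∀ N ω, a N ω = e (-1) ω + ∑ k ∈ Finset.range N, P k ω := by
    intro N ω
    have := Finset.sum_range_sub (fun k : ℕ => e (k - 1) ω) N
    simp only [Nat.cast_add, Nat.cast_one, add_sub_cancel_right, Nat.cast_zero, zero_sub] at this
    simp only [hP_def, ha_def, Pi.sub_apply]
    rw [this]
    abel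
  have hc : ∀ N ω, c N ω = e (-1) ω - ∑ k ∈ Finset.range N, P (-(k + 1)) ω := by
    intro N ω
    have := Finset.sum_range_sub' (fun k : ℕ => e (-k - 1) ω) N
    simp only [Nat.cast_zero, neg_zero, zero_sub] at this
    simp only [hP_def, hc_def, Pi.sub_apply]
    have h2 : ∀ k : ℕ, e (-((k : ℤ) + 1)) ω - e (-((k : ℤ) + 1) - 1) ω
        = e (-k - 1) ω - e (-((k + 1 : ℕ) : ℤ) - 1) ω := by
      intro k
      congr 2
      ring_nf
    rw [Finset.sum_congr rfl fun k _ => h2 k, this]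
    abel
  have hinj1 : Function.Injective fun k : ℕ => (k : ℤ) := Nat.cast_injective
  have hinj2 : Function.Injective fun k : ℕ => -((k : ℤ) + 1) := fun k l h => by
    simpa using h
  have hbd : ∀ {ι : ℕ → ℤ}, Function.Injective ι → ∀ (N : ℕ) (ω : Ω),
      ‖∑ k ∈ Finset.range N, P (ι k) ω‖ₑ ≤ ∑' n, ‖P n ω‖ₑ := fun hι N ω =>
    (enorm_sum_le _ _).trans ((ENNReal.sum_le_tsum _).trans
      (ENNReal.tsum_comp_le_tsum_of_injective hι _))
  have hreal : ∀ {x : E} {y : ℝ≥0∞}, y < ∞ → ‖x‖ₑ ≤ y → ‖x‖ ≤ y.toReal := fun hy h => by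
    rw [← toReal_enorm]; exact ENNReal.toReal_mono hy.ne h
  have habd : ∀ N, ∀ᵐ ω ∂μ, ‖a N ω‖ ≤ (‖e (-1) ω‖ₑ + ∑' n, ‖P n ω‖ₑ).toReal := fun N => by
    filter_upwards [hGfin] with ω hω
    refine hreal hω ?_
    rw [ha]
    exact (enorm_add_le _ _).trans (by gcongr; exact hbd hinj1 N ω)
  have hcbd : ∀ N, ∀ᵐ ω ∂μ, ‖c N ω‖ ≤ (‖e (-1) ω‖ₑ + ∑' n, ‖P n ω‖ₑ).toReal := fun N => by
    filter_upwards [hGfin] with ω hω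
    refine hreal hω ?_
    rw [hc]
    exact enorm_sub_le.trans (by gcongr; exact hbd hinj2 N ω)
  have hPs : ∀ᵐ ω ∂μ, Summable fun n => P n ω := by
    filter_upwards [hGfin] with ω hω
    refine Summable.of_enorm ?_
    exact (lt_of_le_of_lt le_add_self hω).ne
  -- Pointwise `limUnder` makes `V` and `W` measurable for the supremum and the infimum of the
  -- σ-algebras themselves, with no null-set correction.
  set V : Ω → E := fun ω => limUnder atTop (fun N => a N ω) with hV_def
  set W : Ω → E := fun ω => limUnder atTop (fun N => c N ω) with hW_def
  have hVlim : ∀ᵐ ω ∂μ, Tendsto (fun N => a N ω) atTop (𝓝 (V ω)) := by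
    filter_upwards [hPs] with ω hω
    have := (hω.comp_injective hinj1).hasSum.tendsto_sum_nat.const_add (e (-1) ω)
    exact tendsto_nhds_limUnder ⟨_, this.congr fun N => (ha N ω).symm⟩
  have hWlim : ∀ᵐ ω ∂μ, Tendsto (fun N => c N ω) atTop (𝓝 (W ω)) := by
    filter_upwards [hPs] with ω hω
    have := (hω.comp_injective hinj2).hasSum.tendsto_sum_nat.const_sub (e (-1) ω)
    exact tendsto_nhds_limUnder ⟨_, this.congr fun N => (hc N ω).symm⟩
  have hVi : Integrable V μ :=
    hGi.mono' (aestronglyMeasurable_of_tendsto_ae atTop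
      (fun N => (hem' _).aestronglyMeasurable) hVlim) (by
        filter_upwards [hVlim, ae_all_iff.2 habd] with ω h1 h2
        exact le_of_tendsto' h1.norm h2)
  have hWi : Integrable W μ :=
    hGi.mono' (aestronglyMeasurable_of_tendsto_ae atTop
      (fun N => (hem' _).aestronglyMeasurable) hWlim) (by
        filter_upwards [hWlim, ae_all_iff.2 hcbd] with ω h1 h2
        exact le_of_tendsto' h1.norm h2)
  -- On a set of `𝓕 n` the integrals of `a N` eventually equal that of `X`; dominated convergence
  -- passes this to `V`, and a π-λ argument extends it to the supremum.
  have hVX : V =ᵐ[μ] X := by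
    refine EventuallyEq.trans ?_ hsup.symm
    refine ae_eq_condExp_of_forall_setIntegral_eq (iSup_le hle) hX
      (fun s _ _ => hVi.integrableOn) (fun s hs _ => ?_) ?_
    · refine setIntegral_eq_of_iSup h𝓕 hle hVi hX (fun n A hA => ?_) hs
      have h1 : Tendsto (fun N => ∫ ω in A, a N ω ∂μ) atTop (𝓝 (∫ ω in A, V ω ∂μ)) :=
        tendsto_integral_of_dominated_convergence _
          (fun N => (hem' _).aestronglyMeasurable) hGi.integrableOn
          (fun N => ae_restrict_of_ae (habd N)) (ae_restrict_of_ae hVlim)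
      refine tendsto_nhds_unique h1 (tendsto_const_nhds.congr' ?_)
      filter_upwards [eventually_ge_atTop (n + 1).toNat] with N hN
      exact (heint _ A (h𝓕 (by omega) _ hA)).symm
    · have h1 : ∀ N : ℕ, StronglyMeasurable[⨆ n, 𝓕 n] (a N) := fun N =>
        (hem _).mono (le_iSup 𝓕 _)
      have h2 : StronglyMeasurable[⨆ n, 𝓕 n] V :=
        @StronglyMeasurable.limUnder _ _ _ (⨆ n, 𝓕 n) _ _ _ _ _ _ _ h1
      exact h2.aestronglyMeasurable
  have hW0 : W =ᵐ[μ] 0 := by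
    refine EventuallyEq.trans ?_ hinf
    refine ae_eq_condExp_of_forall_setIntegral_eq ((iInf_le 𝓕 0).trans (hle 0)) hX
      (fun s _ _ => hWi.integrableOn) (fun A hA _ => ?_) ?_
    · have h1 : Tendsto (fun N => ∫ ω in A, c N ω ∂μ) atTop (𝓝 (∫ ω in A, W ω ∂μ)) :=
        tendsto_integral_of_dominated_convergence _
          (fun N => (hem' _).aestronglyMeasurable) hGi.integrableOn
          (fun N => ae_restrict_of_ae (hcbd N)) (ae_restrict_of_ae hWlim)
      refine tendsto_nhds_unique h1 (tendsto_const_nhds.congr fun N => ?_)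
      exact (heint _ A (iInf_le 𝓕 _ _ hA)).symm
    · exact (stronglyMeasurable_limUnder_iInf h𝓕
        fun N => (hem _).mono (h𝓕 (by omega))).aestronglyMeasurable
  -- Almost surely `X` is `e (-1)` plus the forward increments, and `0` is `e (-1)` minus the
  -- backward ones; eliminating `e (-1)` gives the two-sided sum.
  filter_upwards [hPs, hVlim, hWlim, hVX, hW0] with ω h1 h2 h3 h4 h5
  rw [h4] at h2
  rw [h5] at h3
  simp only [ha] at h2
  simp only [hc] at h3
  have e1 := tendsto_nhds_unique h2 ((h1.comp_injective hinj1).hasSum.tendsto_sum_nat.const_add _)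
  have e2 := tendsto_nhds_unique h3 ((h1.comp_injective hinj2).hasSum.tendsto_sum_nat.const_sub _)
  have hs := HasSum.of_nat_of_neg_add_one (f := fun n => P n ω)
    (h1.comp_injective hinj1).hasSum (h1.comp_injective hinj2).hasSum
  have : X ω = ∑' k, ((fun n => P n ω) ∘ fun k : ℕ => (k : ℤ)) k
      + ∑' k, ((fun n => P n ω) ∘ fun k : ℕ => -((k : ℤ) + 1)) k := by
    rw [e1, ← sub_eq_zero.1 e2.symm]
    exact add_comm _ _
  rw [this]
  exact hs

end Regular

section Shift

variable {Ω : Type u} {F₀ : MeasurableSpace Ω} [mΩ : MeasurableSpace Ω] {μ : Measure Ω}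
  [IsProbabilityMeasure μ] {θ : Ω ≃ᵐ Ω} {E : Type w} [NormedAddCommGroup E] [NormedSpace ℝ E]
  [CompleteSpace E]

lemma hasSum_projDiff [SecondCountableTopology E] (hF₀ : F₀ ≤ mΩ) (hF : F₀ ≤ F₀.comap θ)
    {X : Ω → E} (hX : IsRegularVariable F₀ μ θ X) {p : ℝ} (hp : 1 ≤ p)
    (hn : hannanNorm F₀ μ θ p X ≠ ∞) :
    ∀ᵐ ω ∂μ, HasSum (fun n => projDiff F₀ μ θ n X ω) (X ω) := by
  obtain ⟨hXi, hinf, hsup⟩ := hX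
  refine hasSum_condExp_sub_condExp (monotone_shiftAlgebra hF) (shiftAlgebra_le hF₀) hXi hinf
    ((sub_ae_eq_zero _ _).1 hsup) (ne_top_of_le_ne_top hn (ENNReal.tsum_le_tsum fun n => ?_))
  rw [← eLpNorm_one_eq_lintegral_enorm]
  exact eLpNorm_le_eLpNorm_of_exponent_le (by simpa using hp)
    (integrable_projDiff n X).aestronglyMeasurable

end Shift

/-! ### The maximal function and the strong law. -/

section Maximal

variable {Ω : Type u} {mΩ : MeasurableSpace Ω} {μ : Measure Ω} {T : Ω → Ω}
  {E : Type w} [NormedAddCommGroup E]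

lemma measurable_mzMaximal (hT : Measurable T) {X : Ω → E} (hX : StronglyMeasurable X) (p : ℝ) :
    Measurable (mzMaximal T p X) := by
  refine Measurable.iSup fun n => Measurable.iSup fun _ => ?_
  have : StronglyMeasurable (birkhoffSum T X n) :=
    Finset.stronglyMeasurable_fun_sum _ fun k _ => hX.comp_measurable (hT.iterate k)
  exact this.enorm.div_const _

lemma mzMaximal_le_tsum {ι : Type*} {X : Ω → E} {Y : ι → Ω → E} {ω : Ω}
    (h : ∀ k, HasSum (fun i => Y i (T^[k] ω)) (X (T^[k] ω))) (p : ℝ) :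
    mzMaximal T p X ω ≤ ∑' i, mzMaximal T p (Y i) ω := by
  refine iSup₂_le fun n hn => ?_
  have hs : HasSum (fun i => birkhoffSum T (Y i) n ω) (birkhoffSum T X n ω) :=
    hasSum_sum fun k _ => h k
  rw [← hs.tsum_eq]
  calc _ ≤ (∑' i, ‖birkhoffSum T (Y i) n ω‖ₑ) / (n : ℝ≥0∞) ^ (1 / p) := by
        gcongr
        exact enorm_tsum_le_tsum_enorm
    _ = ∑' i, ‖birkhoffSum T (Y i) n ω‖ₑ / (n : ℝ≥0∞) ^ (1 / p) := by
        simp_rw [div_eq_mul_inv]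
        rw [ENNReal.tsum_mul_right]
    _ ≤ _ := ENNReal.tsum_le_tsum fun i => le_iSup₂_of_le n hn le_rfl

lemma ae_forall_iterate (hT : MeasurePreserving T μ μ) {q : Ω → Prop} (h : ∀ᵐ ω ∂μ, q ω) :
    ∀ᵐ ω ∂μ, ∀ k, q (T^[k] ω) :=
  ae_all_iff.2 fun k => (hT.iterate k).quasiMeasurePreserving.ae h

lemma norm_birkhoffSum_le_of_mzMaximal_le {p : ℝ} {X : Ω → E} {ω : Ω} {a : ℝ} (ha : 0 ≤ a)
    (h : mzMaximal T p X ω ≤ ENNReal.ofReal a) {n : ℕ} (hn : 1 ≤ n) :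
    ‖birkhoffSum T X n ω‖ ≤ a * (n : ℝ) ^ (1 / p) := by
  have hn0 : (0 : ℝ) < n := by exact_mod_cast hn
  have hb : 0 < (n : ℝ) ^ (1 / p) := by positivity
  have h1 : ‖birkhoffSum T X n ω‖ₑ / (n : ℝ≥0∞) ^ (1 / p) ≤ ENNReal.ofReal a :=
    (le_iSup₂_of_le n hn le_rfl).trans h
  rw [← ENNReal.ofReal_natCast, ENNReal.ofReal_rpow_of_pos hn0,
    ENNReal.div_le_iff (by simpa using hb) (by simp), ← ENNReal.ofReal_mul ha, ← ofReal_norm,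
    ENNReal.ofReal_le_ofReal_iff (by positivity)] at h1
  exact h1

/-- The Marcinkiewicz–Zygmund strong law: `|S_n(X)| / n ^ (1 / p) → 0` almost surely. -/
def HasMZLaw (μ : Measure Ω) (T : Ω → Ω) (p : ℝ) (X : Ω → E) : Prop :=
  ∀ᵐ ω ∂μ, Tendsto (fun n : ℕ => ‖birkhoffSum T X n ω‖ / (n : ℝ) ^ (1 / p)) atTop (𝓝 0)

lemma HasMZLaw.sum {ι : Type*} {p : ℝ} {s : Finset ι} {X : ι → Ω → E}
    (h : ∀ i ∈ s, HasMZLaw μ T p (X i)) : HasMZLaw μ T p (∑ i ∈ s, X i) := by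
  have h' := (ae_ball_iff s.countable_toSet).2 h
  filter_upwards [h'] with ω hω
  have h1 := tendsto_finsetSum s hω
  rw [Finset.sum_const_zero] at h1
  refine squeeze_zero (fun n => by positivity) (fun n => ?_) h1
  rw [← Finset.sum_div]
  gcongr
  refine le_trans (le_of_eq ?_) (norm_sum_le _ _)
  simp only [birkhoffSum, Finset.sum_apply]
  rw [Finset.sum_comm]

/-- The class of functions satisfying the strong law is closed with respect to the weak-type
seminorm of the maximal function. -/
lemma HasMZLaw.of_approx [IsFiniteMeasure μ] {p : ℝ} (hp : 0 < p) {X : Ω → E} {K : ℝ≥0∞}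
    (hK : K ≠ ∞)
    (h : ∀ η : ℝ≥0∞, η ≠ 0 → ∃ Y, HasMZLaw μ T p Y ∧ ∀ t, t ≠ 0 → t ≠ ∞ →
      t ^ p * μ {ω | t < mzMaximal T p (X - Y) ω} ≤ K * η ^ p) :
    HasMZLaw μ T p X := by
  have hη : ∀ j : ℕ, ((j : ℝ≥0∞) + 1)⁻¹ ≠ 0 := fun j => by simp
  choose Y hY hYt using fun j : ℕ => h _ (hη j)
  have hlim : Tendsto (fun j : ℕ => K * (((j : ℝ≥0∞) + 1)⁻¹) ^ p) atTop (𝓝 0) := by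
    have h1 : Tendsto (fun j : ℕ => ((j : ℝ≥0∞) + 1)⁻¹) atTop (𝓝 0) := by
      have := (tendsto_add_atTop_iff_nat 1).2 ENNReal.tendsto_inv_nat_nhds_zero
      simpa using this
    have h2 := ENNReal.Tendsto.const_mul
      ((ENNReal.continuous_rpow_const (y := p)).continuousAt.tendsto.comp h1)
      (Or.inr hK)
    simpa [Function.comp_def, hp] using h2
  have hex : ∀ m : ℕ, ∀ᵐ ω ∂μ, ∃ j, mzMaximal T p (X - Y j) ω ≤ ENNReal.ofReal (1 / ((m : ℝ) + 1)) := by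
    intro m
    have hm : (0 : ℝ) < 1 / ((m : ℝ) + 1) := by positivity
    set t := ENNReal.ofReal (1 / ((m : ℝ) + 1)) with ht_def
    have ht0 : t ≠ 0 := by simpa [ht_def] using hm
    -- No almost sure convergence of approximants is needed: outside this null intersection some
    -- `j`, depending on `ω`, works for the given level.
    have h0 : t ^ p * μ (⋂ j, {ω | t < mzMaximal T p (X - Y j) ω}) = 0 := by
      refine le_antisymm (ge_of_tendsto' hlim fun j => ?_) zero_le
      refine le_trans ?_ (hYt j t ht0 ENNReal.ofReal_ne_top)
      gcongr
      exact Set.iInter_subset _ j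
    rw [mul_eq_zero] at h0
    have h1 := h0.resolve_left (ENNReal.rpow_pos (pos_iff_ne_zero.2 ht0) ENNReal.ofReal_ne_top).ne'
    refine measure_mono_null (fun ω hω => ?_) h1
    simp only [Set.mem_compl_iff, Set.mem_ofPred_eq, not_exists, not_le] at hω
    exact Set.mem_iInter.2 hω
  filter_upwards [ae_all_iff.2 hex, ae_all_iff.2 hY] with ω h1 h2
  rw [Metric.tendsto_atTop]
  intro ε hε
  obtain ⟨m, hm⟩ := exists_nat_one_div_lt (half_pos hε)
  obtain ⟨j, hj⟩ := h1 m
  obtain ⟨N, hN⟩ := Metric.tendsto_atTop.1 (h2 j) _ (half_pos hε)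
  refine ⟨max N 1, fun n hn => ?_⟩
  have hn1 : 1 ≤ n := (le_max_right _ _).trans hn
  have hb : 0 < (n : ℝ) ^ (1 / p) := Real.rpow_pos_of_pos (by exact_mod_cast hn1) _
  have h3 := hN n ((le_max_left _ _).trans hn)
  have h4 := norm_birkhoffSum_le_of_mzMaximal_le (by positivity) hj hn1
  have h5 : birkhoffSum T X n ω = birkhoffSum T (X - Y j) n ω + birkhoffSum T (Y j) n ω := by
    simp [birkhoffSum]
  rw [dist_zero_right, Real.norm_of_nonneg (by positivity)] at h3 ⊢
  rw [div_lt_iff₀ hb] at h3 ⊢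
  calc _ ≤ ‖birkhoffSum T (X - Y j) n ω‖ + ‖birkhoffSum T (Y j) n ω‖ := by
        rw [h5]; exact norm_add_le _ _
    _ < ε / 2 * (n : ℝ) ^ (1 / p) + ε / 2 * (n : ℝ) ^ (1 / p) := by
        refine add_lt_add_of_le_of_lt (h4.trans ?_) h3
        gcongr
    _ = _ := by ring

/-- A weak-type bound at an exponent `q > p` yields the strong law at exponent `p`. -/
lemma HasMZLaw.of_weak_bound {p q : ℝ} (hp : 0 < p) (hpq : p < q) {X : Ω → E} {K : ℝ≥0∞}
    (hK : K ≠ ∞) (h : ∀ t, t ≠ 0 → t ≠ ∞ → t ^ q * μ {ω | t < mzMaximal T q X ω} ≤ K) :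
    HasMZLaw μ T p X := by
  have hq : 0 < q := hp.trans hpq
  -- Finiteness of the maximal function gives `S_n = O(n ^ (1 / q))`, and the spare power `1 / p - 1
  -- / q` tends to zero.
  have hfin : ∀ᵐ ω ∂μ, mzMaximal T q X ω ≠ ∞ := by
    have hle : ∀ j : ℕ, μ {ω | ¬ mzMaximal T q X ω ≠ ∞} ≤ K * ((((j : ℝ≥0∞) + 1)⁻¹) ^ q) := by
      intro j
      have hj0 : ((j : ℝ≥0∞) + 1) ≠ 0 := by simp
      have hjt : ((j : ℝ≥0∞) + 1) ≠ ∞ := by simp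
      rw [ENNReal.inv_rpow, ← div_eq_mul_inv, ENNReal.le_div_iff_mul_le
        (Or.inl (by simp [hj0, hjt])) (Or.inl (by simp [hj0, hjt])), mul_comm]
      refine le_trans ?_ (h _ hj0 hjt)
      gcongr
      intro hω
      rw [not_not] at hω
      rw [hω]
      exact hjt.lt_top
    have hlim : Tendsto (fun j : ℕ => K * (((j : ℝ≥0∞) + 1)⁻¹) ^ q) atTop (𝓝 0) := by
      have h1 : Tendsto (fun j : ℕ => ((j : ℝ≥0∞) + 1)⁻¹) atTop (𝓝 0) := by
        have := (tendsto_add_atTop_iff_nat 1).2 ENNReal.tendsto_inv_nat_nhds_zero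
        simpa using this
      have h2 := ENNReal.Tendsto.const_mul
        ((ENNReal.continuous_rpow_const (y := q)).continuousAt.tendsto.comp h1)
        (Or.inr hK)
      simpa [Function.comp_def, hq] using h2
    exact le_antisymm (ge_of_tendsto' hlim hle) zero_le
  filter_upwards [hfin] with ω hω
  set a := (mzMaximal T q X ω).toReal with ha_def
  have ha : mzMaximal T q X ω ≤ ENNReal.ofReal a := (ENNReal.ofReal_toReal hω).ge
  have hexp : 0 < 1 / p - 1 / q := sub_pos.2 (one_div_lt_one_div_of_lt hp hpq)
  have hlim : Tendsto (fun n : ℕ => a * (n : ℝ) ^ (-(1 / p - 1 / q))) atTop (𝓝 0) := by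
    simpa using ((tendsto_rpow_neg_atTop hexp).comp tendsto_natCast_atTop_atTop).const_mul a
  refine squeeze_zero' (Eventually.of_forall fun n => by positivity) ?_ hlim
  filter_upwards [eventually_ge_atTop 1] with n hn
  have hn0 : (0 : ℝ) < n := by exact_mod_cast hn
  rw [div_le_iff₀ (by positivity), mul_assoc, ← Real.rpow_add hn0]
  refine (norm_birkhoffSum_le_of_mzMaximal_le ENNReal.toReal_nonneg ha hn).trans (le_of_eq ?_)
  congr 2
  ring

end Maximal

/-! ### Strong law and maximal inequality for regular variables. -/

section Shift

variable {Ω : Type u} {F₀ : MeasurableSpace Ω} [mΩ : MeasurableSpace Ω] {μ : Measure Ω}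
  [IsProbabilityMeasure μ] {θ : Ω ≃ᵐ Ω} {E : Type w} [NormedAddCommGroup E] [NormedSpace ℝ E]
  [CompleteSpace E]

/-- Splits `Y` at a high level and recentres both parts, which keeps them martingale differences.
The large part has small `L^p` norm; the bounded part has a weak-type bound at the exponent `(p + r)
/ 2`, strictly between `p` and `r`. -/
lemma hasMZLaw_of_condExp_eq_zero {p r D : ℝ} (hp : 1 < p)
    (hpr : p < r) (hr : r ≤ 2) (hD : 1 ≤ D) (hE : IsSmoothSpace.{u, w} r D E)
    (hθ : MeasurePreserving θ μ μ) (hF₀ : F₀ ≤ mΩ) (hF : F₀ ≤ F₀.comap θ) {n : ℤ} {Y : Ω → E}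
    (hY : StronglyMeasurable[shiftAlgebra F₀ θ n] Y) (hYp : MemLp Y (ENNReal.ofReal p) μ)
    (hz : μ[Y | shiftAlgebra F₀ θ (n - 1)] =ᵐ[μ] 0) : HasMZLaw μ θ p Y := by
  have hp0 : 0 < p := by linarith
  have hp1 : (1 : ℝ≥0∞) ≤ ENNReal.ofReal p := by simpa using hp.le
  have hYi : Integrable Y μ := hYp.integrable hp1
  have hle : shiftAlgebra F₀ θ (n - 1) ≤ mΩ := shiftAlgebra_le hF₀ _
  have hle' : shiftAlgebra F₀ θ n ≤ mΩ := shiftAlgebra_le hF₀ _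
  refine HasMZLaw.of_approx hp0
    (K := ENNReal.ofReal (3 ^ p * weakTypeConst p r * D ^ r) * 2 ^ p)
    (ENNReal.mul_ne_top ENNReal.ofReal_ne_top (by simp)) fun η hη => ?_
  obtain ⟨ε, hε, hεη⟩ : ∃ ε : ℝ, 0 < ε ∧ ENNReal.ofReal ε ≤ η := by
    obtain ⟨ε, hε, hεη⟩ := ENNReal.lt_iff_exists_nnreal_btwn.1 (pos_iff_ne_zero.2 hη)
    exact ⟨ε, by simpa using hε, by simpa using hεη.le⟩
  obtain ⟨M, hM⟩ := hYp.eLpNorm_indicator_norm_ge_le (hY.mono hle') hε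
  set A : Set Ω := {ω | M ≤ ‖Y ω‖₊} with hA_def
  have hA : MeasurableSet[shiftAlgebra F₀ θ n] A :=
    measurableSet_le measurable_const hY.norm.measurable
  set hi : Ω → E := A.indicator Y with hhi_def
  have hhim : StronglyMeasurable[shiftAlgebra F₀ θ n] hi := hY.indicator hA
  have hhii : Integrable hi μ := hYi.indicator (hle' _ hA)
  set Z : Ω → E := hi - μ[hi | shiftAlgebra F₀ θ (n - 1)] with hZ_def
  have hZm : StronglyMeasurable[shiftAlgebra F₀ θ n] Z :=
    hhim.sub (stronglyMeasurable_condExp.mono (monotone_shiftAlgebra hF (by omega)))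
  have hZi : Integrable Z μ := hhii.sub integrable_condExp
  have hZz : μ[Z | shiftAlgebra F₀ θ (n - 1)] =ᵐ[μ] 0 := condExp_sub_condExp_self hle hhii
  refine ⟨Y - Z, ?_, fun t ht0 ht => ?_⟩
  · have hq1 : 1 < (p + r) / 2 := by linarith
    -- Since `Y` has zero conditional expectation, removing the recentred large part leaves the
    -- recentred bounded part.
    have hdiff : Y - Z =ᵐ[μ] (Y - hi) - μ[Y - hi | shiftAlgebra F₀ θ (n - 1)] := by
      filter_upwards [condExp_sub hYi hhii (shiftAlgebra F₀ θ (n - 1)), hz] with ω h1 h2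
      simp only [hZ_def, Pi.sub_apply, h1, h2, Pi.zero_apply]
      abel
    have hbd : ∀ ω, ‖(Y - hi) ω‖ ≤ |M| := by
      intro ω
      by_cases h : ω ∈ A
      · simp [hhi_def, h]
      · have h' : ¬ M ≤ ‖Y ω‖ := h
        simp only [hhi_def, Pi.sub_apply, Set.indicator_of_notMem h, sub_zero]
        exact (not_le.1 h').le.trans (le_abs_self M)
    have hmem : MemLp (Y - hi) (ENNReal.ofReal ((p + r) / 2)) μ :=
      MemLp.of_bound (hYi.sub hhii).aestronglyMeasurable |M| (Eventually.of_forall hbd)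
    refine HasMZLaw.of_weak_bound hp0 (q := (p + r) / 2) (by linarith)
      (ENNReal.mul_ne_top ENNReal.ofReal_ne_top
        (ENNReal.rpow_ne_top_of_nonneg (by linarith) (ne_of_lt ?_)))
      fun t ht0 ht => rpow_mul_measure_lt_mzMaximal_shift_le hq1 (by linarith) hr hD hE hθ hF₀ hF
        (hY.sub hZm) (hYi.sub hZi) ?_ ht0 ht
    · rw [eLpNorm_congr_ae hdiff]
      exact (eLpNorm_sub_condExp_le (by simpa using hq1.le) _ hmem.1).trans_lt
        (ENNReal.mul_lt_top (by simp) hmem.2)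
    · filter_upwards [condExp_sub hYi hZi (shiftAlgebra F₀ θ (n - 1)), hz, hZz] with ω h1 h2 h3
      rw [h1, Pi.sub_apply, h2, h3]
      simp
  · rw [sub_sub_cancel]
    refine (rpow_mul_measure_lt_mzMaximal_shift_le hp hpr hr hD hE hθ hF₀ hF hZm hZi hZz
      ht0 ht).trans ?_
    rw [mul_assoc (ENNReal.ofReal _), ← ENNReal.mul_rpow_of_nonneg _ _ hp0.le]
    gcongr
    refine (eLpNorm_sub_condExp_le hp1 _ hhii.aestronglyMeasurable).trans ?_
    gcongr
    exact hM.trans hεη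

/-- The weak-type bound for a function represented by a family of increments of `X`. -/
lemma rpow_mul_measure_lt_mzMaximal_le_tsum {p r D : ℝ} (hp : 1 < p)
    (hpr : p < r) (hr : r ≤ 2) (hD : 1 ≤ D) (hE : IsSmoothSpace.{u, w} r D E)
    (hθ : MeasurePreserving θ μ μ) (hF₀ : F₀ ≤ mΩ) (hF : F₀ ≤ F₀.comap θ) {X Z : Ω → E}
    {ι : Type*} [Countable ι] (m : ι → ℤ)
    (hZ : ∀ᵐ ω ∂μ, HasSum (fun i => projDiff F₀ μ θ (m i) X ω) (Z ω))
    (hsum : ∑' i, eLpNorm (projDiff F₀ μ θ (m i) X) (ENNReal.ofReal p) μ ≠ ∞)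
    {t : ℝ≥0∞} (ht0 : t ≠ 0) (ht : t ≠ ∞) :
    t ^ p * μ {ω | t < mzMaximal θ p Z ω}
      ≤ 2 ^ p * weakSumConst p * ENNReal.ofReal (3 ^ p * weakTypeConst p r * D ^ r)
        * (∑' i, eLpNorm (projDiff F₀ μ θ (m i) X) (ENNReal.ofReal p) μ) ^ p := by
  refine le_trans ?_ (rpow_mul_measure_lt_tsum_le (μ := μ)
    (g := fun i => mzMaximal θ p (projDiff F₀ μ θ (m i) X)) (fun i => ?_) hp
    hsum (fun i t ht0 ht => ?_) ht0 ht)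
  · gcongr t ^ p * ?_
    refine measure_mono_ae ?_
    filter_upwards [ae_forall_iterate hθ hZ] with ω hω h
    exact lt_of_lt_of_le h (mzMaximal_le_tsum hω p)
  · exact measurable_mzMaximal θ.measurable
      ((stronglyMeasurable_projDiff hF (m i) X).mono (shiftAlgebra_le hF₀ _)) p
  · exact rpow_mul_measure_lt_mzMaximal_shift_le hp hpr hr hD hE hθ hF₀ hF
      (stronglyMeasurable_projDiff hF (m i) X) (integrable_projDiff (m i) X)
      (condExp_projDiff hF₀ hF (m i) X) ht0 ht

lemma hasMZLaw_of_hannanNorm_ne_top [SecondCountableTopology E] {p r D : ℝ} (hp : 1 < p)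
    (hpr : p < r) (hr : r ≤ 2) (hD : 1 ≤ D) (hE : IsSmoothSpace.{u, w} r D E)
    (hθ : MeasurePreserving θ μ μ) (hF₀ : F₀ ≤ mΩ) (hF : F₀ ≤ F₀.comap θ) {X : Ω → E}
    (hX : IsRegularVariable F₀ μ θ X) (hn : hannanNorm F₀ μ θ p X ≠ ∞) : HasMZLaw μ θ p X := by
  have hp0 : 0 < p := by linarith
  refine HasMZLaw.of_approx hp0
    (K := 2 ^ p * weakSumConst p * ENNReal.ofReal (3 ^ p * weakTypeConst p r * D ^ r))
    (ENNReal.mul_ne_top (ENNReal.mul_ne_top (by simp) (weakSumConst_ne_top hp))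
      ENNReal.ofReal_ne_top) fun η hη => ?_
  -- Keep finitely many increments so that the Hannan norm of the rest is below `η`; the weak-type
  -- bound over the complement of `s` controls the remainder.
  obtain ⟨s, hs⟩ := ((ENNReal.tendsto_tsum_compl_atTop_zero hn).eventually
    (gt_mem_nhds (pos_iff_ne_zero.2 hη))).exists
  refine ⟨∑ i ∈ s, projDiff F₀ μ θ i X, HasMZLaw.sum fun i _ => ?_, fun t ht0 ht => ?_⟩
  · refine hasMZLaw_of_condExp_eq_zero hp hpr hr hD hE hθ hF₀ hF
      (stronglyMeasurable_projDiff hF i X)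
      ⟨(integrable_projDiff i X).aestronglyMeasurable, ?_⟩ (condExp_projDiff hF₀ hF i X)
    exact (ENNReal.ne_top_of_tsum_ne_top hn i).lt_top
  · refine (rpow_mul_measure_lt_mzMaximal_le_tsum hp hpr hr hD hE hθ hF₀ hF (X := X)
      (fun i : {i // i ∉ s} => (i : ℤ)) ?_ hs.ne_top ht0 ht).trans (by gcongr)
    filter_upwards [hasSum_projDiff hF₀ hF hX hp.le hn] with ω hω
    refine (Finset.hasSum_compl_iff (f := fun i => projDiff F₀ μ θ i X ω) s).2 ?_
    simpa using hω

lemma weakLpNorm_mzMaximal_le [SecondCountableTopology E] {p r D : ℝ} (hp : 1 < p)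
    (hpr : p < r) (hr : r ≤ 2) (hD : 1 ≤ D) (hE : IsSmoothSpace.{u, w} r D E)
    (hθ : MeasurePreserving θ μ μ) (hF₀ : F₀ ≤ mΩ) (hF : F₀ ≤ F₀.comap θ) {X : Ω → E}
    (hX : IsRegularVariable F₀ μ θ X) (hn : hannanNorm F₀ μ θ p X ≠ ∞) :
    weakLpNorm μ p (mzMaximal θ p X) ≤
      (2 ^ p * weakSumConst p * ENNReal.ofReal (3 ^ p * weakTypeConst p r)) ^ (1 / p)
        * ENNReal.ofReal (D ^ (r / p)) * hannanNorm F₀ μ θ p X := by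
  have hp0 : 0 < p := by linarith
  have hip : 0 ≤ 1 / p := by positivity
  have hD0 : 0 < D := by linarith
  have hw := one_le_weakTypeConst hp hpr
  have hinv : ∀ x : ℝ≥0∞, (x ^ p) ^ (1 / p) = x := fun x => by
    rw [← ENNReal.rpow_mul, mul_one_div_cancel hp0.ne', ENNReal.rpow_one]
  refine iSup₂_le fun t ht => ?_
  have h := ENNReal.rpow_le_rpow (rpow_mul_measure_lt_mzMaximal_le_tsum hp hpr hr hD hE hθ hF₀ hF
    (X := X) (fun i : ℤ => i) (hasSum_projDiff hF₀ hF hX hp.le hn) hn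
    (t := ENNReal.ofReal t) (by simpa using ht) ENNReal.ofReal_ne_top) hip
  rw [ENNReal.mul_rpow_of_nonneg _ _ hip, hinv, ENNReal.ofReal_mul (by positivity), ← mul_assoc,
    ENNReal.mul_rpow_of_nonneg _ _ hip, hinv, ENNReal.mul_rpow_of_nonneg _ _ hip,
    ENNReal.ofReal_rpow_of_pos (by positivity), ← Real.rpow_mul hD0.le, mul_one_div] at h
  exact h

end Shift

/-! ### The lower bound on `D` and the conclusion. -/

/-- A nontrivial smooth space has smoothness constant at least one. -/
lemma IsSmoothSpace.one_le {r D : ℝ} {E : Type w} [NormedAddCommGroup E] [NormedSpace ℝ E]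
    [CompleteSpace E] [Nontrivial E] (hE : IsSmoothSpace.{u, w} r D E) (hr : 0 < r)
    (hD : 0 < D) : 1 ≤ D := by
  obtain ⟨x, hx⟩ := exists_ne (0 : E)
  let mS : MeasurableSpace (ULift.{u} Bool) := ⊤
  let ν : Measure (ULift.{u} Bool) :=
    (2⁻¹ : ℝ≥0∞) • (Measure.dirac ⟨true⟩ + Measure.dirac ⟨false⟩)
  have hν : IsProbabilityMeasure ν := ⟨by
    simp only [ν, Measure.smul_apply, Measure.add_apply, measure_univ, smul_eq_mul]
    rw [one_add_one_eq_two, ENNReal.inv_mul_cancel (by simp) (by simp)]⟩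
  let 𝒢 : Filtration ℕ mS :=
    { seq := fun n => if n = 0 then ⊥ else ⊤
      mono' := fun n m h => by
        rcases Nat.eq_zero_or_pos n with rfl | hn
        · simp
        · simp [hn.ne', (hn.trans_le h).ne']
      le' := fun n => le_top }
  -- A single fair sign times `x` is a martingale difference of constant norm, so smoothness with `N
  -- = 1` reads `‖x‖ ^ r ≤ D ^ r * ‖x‖ ^ r`.
  let d : ULift.{u} Bool → E := fun s => if s.down then x else -x
  have hdm : StronglyMeasurable d := StronglyMeasurable.of_discrete
  have hnorm : ∀ s, ‖d s‖ₑ = ‖x‖ₑ := fun s => by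
    rcases s with ⟨s⟩
    cases s <;> simp [d]
  have hdi : Integrable d ν := by
    refine Integrable.of_bound hdm.aestronglyMeasurable ‖x‖ (Eventually.of_forall fun s => ?_)
    rw [← toReal_enorm, hnorm, toReal_enorm]
  have hint : ∫ s, d s ∂ν = 0 := by
    have hi1 : Integrable d (Measure.dirac (⟨true⟩ : ULift.{u} Bool)) :=
      integrable_dirac (by simp)
    have hi2 : Integrable d (Measure.dirac (⟨false⟩ : ULift.{u} Bool)) :=
      integrable_dirac (by simp)
    rw [integral_smul_measure, integral_add_measure hi1 hi2, integral_dirac, integral_dirac]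
    simp [d]
  have h := hE (ULift.{u} Bool) ν 𝒢 1 (fun _ => d)
    (fun n _ => by
      have : 𝒢 (n + 1) = (⊤ : MeasurableSpace (ULift.{u} Bool)) :=
        (if_neg n.succ_ne_zero :
          (if n + 1 = 0 then (⊥ : MeasurableSpace (ULift.{u} Bool)) else ⊤) = ⊤)
      rw [this]
      exact hdm)
    (fun _ _ => hdi)
    (fun n hn => by
      obtain rfl : n = 0 := by omega
      have : 𝒢 0 = (⊥ : MeasurableSpace (ULift.{u} Bool)) :=
        (if_pos rfl : (if 0 = 0 then (⊥ : MeasurableSpace (ULift.{u} Bool)) else ⊤) = ⊥)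
      rw [this, condExp_bot, hint]
      rfl)
  simp only [Finset.sum_range_one, hnorm, lintegral_const, measure_univ, mul_one] at h
  have hx0 : ‖x‖ₑ ^ r ≠ 0 := (ENNReal.rpow_pos (enorm_pos.2 hx) enorm_ne_top).ne'
  have hxt : ‖x‖ₑ ^ r ≠ ∞ := ENNReal.rpow_ne_top_of_nonneg hr.le enorm_ne_top
  have h1 : 1 ≤ ENNReal.ofReal (D ^ r) := by
    rw [← ENNReal.mul_le_mul_iff_left hx0 hxt, one_mul]
    exact h
  rw [ENNReal.one_le_ofReal] at h1
  by_contra hcon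
  exact (Real.rpow_lt_one hD.le (not_le.1 hcon) hr).not_ge h1

theorem mainTheorem4 (p r : ℝ) (hp : 1 < p) (hpr : p < r) (hr : r ≤ 2) :
    ∃ C : ℝ, 0 < C ∧
      ∀ (D : ℝ) (_ : 0 < D)
        (E : Type w) [NormedAddCommGroup E] [NormedSpace ℝ E] [CompleteSpace E]
        [TopologicalSpace.SeparableSpace E] (_ : IsSmoothSpace.{u, w} r D E)
        (Ω : Type u) (F₀ : MeasurableSpace Ω) [mΩ : MeasurableSpace Ω] (μ : Measure Ω) [IsProbabilityMeasure μ]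
        (θ : Ω ≃ᵐ Ω) (_ : MeasurePreserving θ μ μ)
        (_ : F₀ ≤ mΩ) (_ : F₀ ≤ F₀.comap θ)
        (X : Ω → E) (_ : MemLp X (ENNReal.ofReal p) μ) (_ : IsRegularVariable F₀ μ θ X)
        (_ : hannanNorm F₀ μ θ p X < ∞),
        weakLpNorm μ p (mzMaximal θ p X)
            ≤ ENNReal.ofReal (C * D ^ (r / p)) * hannanNorm F₀ μ θ p X ∧
          ∀ᵐ ω ∂μ, Tendsto (fun n : ℕ => ‖birkhoffSum θ X n ω‖ / (n : ℝ) ^ (1 / p)) atTop (𝓝 0) := by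
  have hp0 : 0 < p := by linarith
  set c : ℝ≥0∞ := (2 ^ p * weakSumConst p * ENNReal.ofReal (3 ^ p * weakTypeConst p r)) ^ (1 / p)
    with hc_def
  have hc : c ≠ ∞ := ENNReal.rpow_ne_top_of_nonneg (by positivity)
    (ENNReal.mul_ne_top (ENNReal.mul_ne_top (by simp) (weakSumConst_ne_top hp))
      ENNReal.ofReal_ne_top)
  refine ⟨c.toReal + 1, by positivity, ?_⟩
  intro D hD E _ _ _ _ hE Ω F₀ mΩ μ _ θ hθ hF₀ hF X _ hX hn
  -- In the zero space `D` may be less than 1, but every sum vanishes.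
  rcases subsingleton_or_nontrivial E with hsub | hnt
  · have hX0 : ∀ n ω, birkhoffSum θ X n ω = 0 := fun n ω => Subsingleton.elim _ _
    have hM : mzMaximal θ p X = 0 := by
      funext ω
      simp [mzMaximal, hX0]
    refine ⟨?_, by simp [hX0]⟩
    simp [hM, weakLpNorm, hp0]
  · have hD1 : 1 ≤ D := hE.one_le (by linarith) hD
    have := UniformSpace.secondCountable_of_separable E
    refine ⟨(weakLpNorm_mzMaximal_le hp hpr hr hD1 hE hθ hF₀ hF hX hn.ne).trans ?_,
      hasMZLaw_of_hannanNorm_ne_top hp hpr hr hD1 hE hθ hF₀ hF hX hn.ne⟩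
    rw [ENNReal.ofReal_mul (p := c.toReal + 1) (by positivity)]
    gcongr
    change c ≤ _
    rw [ENNReal.le_ofReal_iff_toReal_le hc (by positivity)]
    linarith
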